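/- **Theories.** A \emph{theory} $T$ is a small category whose objects are the nonnegative integers, with composition $f\cdot g\colon n\to q$ of $f\colon n\to p$, $g\colon p\to q$ written in diagrammatic order, together with distinguished morphisms $i_n\colon 1\to n$ ($1\le i\le n$, $n\ge 0$) such that $1_1$ is the identity of $1$ and for all $f_1,\dots,f_n\colon 1\to p$ there is a unique $f\colon n\to p$ with $i_n\cdot f=f_i$ for all $i$. A \emph{grove theory} is a theory with a commutative monoid structure $(T(n,p),+,0_{n,p})$ on each hom-set such that $i_n\cdot(f+g)=i_n\cdot f+i_n\cdot g$, $i_n\cdot 0_{n,p}=0_{1,p}$, $(f+g)\cdot h=f\cdot h+g\cdot h$ and $0_{n,p}\cdot h=0_{n,q}$ for all $f,g\colon n\to p$, $h\colon p\to q$. It is \emph{idempotent} if $f+f=f$ for all $f$, and then $f\le g$ means $f+g=g$; an idempotent grove theory is \emph{ordered} if $g\le h$ implies $f\cdot g\le f\cdot h$ for all $f\colon n\to p$ and $g,h\colon p\to q$. Morphisms of ordered idempotent grove theories are functors that are the identity on objects and preserve the distinguished morphisms, $+$ and all $0_{n,p}$. **Trees.** Let $\Sigma=\biguplus_{k\ge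 0}\Sigma_k$ be a ranked set. A \emph{synchronization tree} $t\colon 1\to p$ over $\Sigma$ consists of countable sets of vertices and of edges, a root, and a label in $\Sigma\cup\{\mathsf{ex}_1,\dots,\mathsf{ex}_p\}$ for each edge, where each edge $v\to(v_1,\dots,v_k)$ has a source $v$ and an ordered sequence of targets, with $k$ the rank of its label if this is a letter of $\Sigma$ and $k=0$ if it is one of the exit symbols $\mathsf{ex}_i$, such that each vertex is the target of a unique path from the root. The tree is \emph{finite} if it has finitely many edges. A (finite) synchronization tree $n\to p$ is an $n$-tuple of (finite) synchronization trees $1\to p$. For $t\colon 1\to p$ and $s=(s_1,\dots,s_p)\colon p\to q$, the tree $t\cdot s\colon 1\to q$ is obtained from $t$ by replacing each edge labelled $\mathsf{ex}_i$ by a copy of $s_i$, whose root is merged with the source of this edge; for $t,t'\colon 1\to p$, the tree $t+t'$ is obtained from disjoint copies of $t$ and $t'$ by merging the roots; $0_{1,p}$ is the tree without edges; $i_n$ is the tree with a single edge, labelled $\mathsf{ex}_i$. Composition (in the first argument), sum and zero are extended to tuples componentwise, and the identity of $n$ is $(1_n,\dots,n_n)$. A letter $\sigma\in\Sigma_k$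 is identified with the tree $1\to k$ that has one edge $r\to(v_1,\dots,v_k)$ labelled $\sigma$, where $r$ is the root, and one edge with source $v_i$ labelled $\mathsf{ex}_i$ for each $1\le i\le k$. A \emph{simulation} $t\to t'$ between trees $1\to p$ is a relation $R$ between their vertices that relates the roots and is such that, whenever $v\to(v_1,\dots,v_k)$ is an edge of $t$ and $v\,R\,v'$, there is an equally labelled edge $v'\to(v'_1,\dots,v'_k)$ of $t'$ with $v_i\,R\,v'_i$ for all $i$; a simulation between trees $n\to p$ is an $n$-tuple of simulations between their components. Two trees are \emph{simulation equivalent} if there are simulations between them in both directions. Let $\mathbf{SFST}_\Sigma$ have as morphisms $n\to p$ the simulation equivalence classes of finite synchronization trees $n\to p$ over $\Sigma$, with the operations induced by those on trees. **Proposition.** For every ranked set $\Sigma$, $\mathbf{SFST}_\Sigma$ is the free ordered idempotent grove theory, freely generated by $\Sigma$. That is, $\mathbf{SFST}_\Sigma$ is an ordered idempotent grove theory, and for every ordered idempotent grove theory $T$ and every rank preserving function $\varphi$ (mapping each $\sigma\in\Sigma_k$ to a morphism $\varphi(\sigma)\colon 1\to k$ of $T$, for all $k\ge 0$) there is a unique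 morphism $\varphi^\sharp\colon\mathbf{SFST}_\Sigma\to T$ of ordered idempotent grove theories with $\varphi^\sharp([\sigma])=\varphi(\sigma)$ for all $\sigma\in\Sigma$. -/

import Mathlib

universe u w

namespace GroveTheory

/-! ### Theories and grove theories -/

/-- The operations of a grove theory whose objects are the natural numbers: hom-sets, composition
in diagrammatic order, identities, the distinguished morphisms `i_n : 1 → n` (with `Fin n` in place
of `[n]`), and a sum and a zero on each hom-set.  The laws are imposed separately below. -/
structure GroveData where
  Hom : ℕ → ℕ → Type w
  comp : ∀ {n p q : ℕ}, Hom n p → Hom p q → Hom n q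
  one : ∀ n : ℕ, Hom n n
  dist : ∀ {n : ℕ}, Fin n → Hom 1 n
  add : ∀ {n p : ℕ}, Hom n p → Hom n p → Hom n p
  zero : ∀ n p : ℕ, Hom n p

namespace GroveData

/-- `T` is a (Lawvere) theory: a category with objects the natural numbers in which each `n` is the
`n`-fold coproduct of `1` with itself, with the distinguished morphisms as coproduct injections,
and in which the distinguished morphism `1 → 1` is the identity. -/
structure IsTheory (T : GroveData) : Prop where
  assoc : ∀ {m n p q : ℕ} (f : T.Hom m n) (g : T.Hom n p) (h : T.Hom p q),
    T.comp (T.comp f g) h = T.comp f (T.comp g h)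
  one_comp : ∀ {n p : ℕ} (f : T.Hom n p), T.comp (T.one n) f = f
  comp_one : ∀ {n p : ℕ} (f : T.Hom n p), T.comp f (T.one p) = f
  tupling : ∀ {n p : ℕ} (f : Fin n → T.Hom 1 p),
    ∃! g : T.Hom n p, ∀ i, T.comp (T.dist i) g = f i
  dist_one : T.dist (0 : Fin 1) = T.one 1

/-- `T` is a grove theory. -/
structure IsGroveTheory (T : GroveData) : Prop extends IsTheory T where
  add_assoc : ∀ {n p : ℕ} (f g h : T.Hom n p), T.add (T.add f g) h = T.add f (T.add g h)
  add_comm : ∀ {n p : ℕ} (f g : T.Hom n p), T.add f g = T.add g f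
  zero_add : ∀ {n p : ℕ} (f : T.Hom n p), T.add (T.zero n p) f = f
  dist_comp_add : ∀ {n p : ℕ} (i : Fin n) (f g : T.Hom n p),
    T.comp (T.dist i) (T.add f g) = T.add (T.comp (T.dist i) f) (T.comp (T.dist i) g)
  dist_comp_zero : ∀ {n : ℕ} (p : ℕ) (i : Fin n),
    T.comp (T.dist i) (T.zero n p) = T.zero 1 p
  add_comp : ∀ {n p q : ℕ} (f g : T.Hom n p) (h : T.Hom p q),
    T.comp (T.add f g) h = T.add (T.comp f h) (T.comp g h)
  zero_comp : ∀ (n : ℕ) {p q : ℕ} (h : T.Hom p q),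
    T.comp (T.zero n p) h = T.zero n q

/-- `T` is an idempotent grove theory. -/
structure IsIdempotentGroveTheory (T : GroveData) : Prop extends IsGroveTheory T where
  add_idem : ∀ {n p : ℕ} (f : T.Hom n p), T.add f f = f

/-- The relation `f ≤ g`, that is, `f + g = g`, on a hom-set. -/
def le (T : GroveData) {n p : ℕ} (f g : T.Hom n p) : Prop :=
  T.add f g = g

/-- `T` is an ordered idempotent grove theory: composition preserves the order `≤` in its second
argument (it does so automatically in its first argument). -/
structure IsOrderedIdempotentGroveTheory (T : GroveData) : Prop
    extends IsIdempotentGroveTheory T where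
  comp_mono : ∀ {n p q : ℕ} (f : T.Hom n p) (g h : T.Hom p q),
    T.le g h → T.le (T.comp f g) (T.comp f h)

/-- Morphisms of (ordered idempotent) grove theories: functors that are the identity on objects and
preserve the distinguished morphisms, the sum and the zeros. -/
structure Morphism (S T : GroveData) where
  map : ∀ {n p : ℕ}, S.Hom n p → T.Hom n p
  map_comp : ∀ {n p q : ℕ} (f : S.Hom n p) (g : S.Hom p q),
    map (S.comp f g) = T.comp (map f) (map g)
  map_one : ∀ n : ℕ, map (S.one n) = T.one n
  map_dist : ∀ {n : ℕ} (i : Fin n), map (S.dist i) = T.dist i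
  map_add : ∀ {n p : ℕ} (f g : S.Hom n p), map (S.add f g) = T.add (map f) (map g)
  map_zero : ∀ n p : ℕ, map (S.zero n p) = T.zero n p

end GroveData

/-! ### Synchronization trees -/

/-- Edge labels of synchronization trees `1 → p` over the ranked set `Sg` (`Sg k` is the set of
letters of rank `k`): letters, and the exit symbols `ex_i`. -/
inductive Label (Sg : ℕ → Type u) (p : ℕ) : Type u
  | letter (k : ℕ) (σ : Sg k) : Label Sg p
  | exit (i : Fin p) : Label Sg p

namespace Label

variable {Sg : ℕ → Type u} {p q : ℕ}

/-- The number of targets of an edge with the given label. -/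
def arity : Label Sg p → ℕ
  | letter k _ => k
  | exit _ => 0

/-- The label is a letter of the ranked set. -/
def IsLetter : Label Sg p → Prop
  | letter _ _ => True
  | exit _ => False

/-- A letter, regarded as a label of trees `1 → q` instead of trees `1 → p`. -/
def relabel (q : ℕ) : (l : Label Sg p) → l.IsLetter → Label Sg q
  | letter k σ, _ => letter k σ
  | exit _, h => h.elim

theorem arity_relabel : ∀ (l : Label Sg p) (h : l.IsLetter),
    (l.relabel q h).arity = l.arity
  | letter _ _, _ => rfl
  | exit _, h => h.elim

end Label

/-- A labelled directed hyper graph with a root.  An edge has one source and an ordered sequence of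
targets; its length is the rank of the label if this is a letter, and `0` if the label is an exit
symbol. -/
structure HyperGraph (Sg : ℕ → Type u) (p : ℕ) where
  V : Type
  E : Type
  root : V
  src : E → V
  label : E → Label Sg p
  tgt : (e : E) → Fin (label e).arity → V

namespace HyperGraph

variable {Sg : ℕ → Type u} {p : ℕ}

/-- A step of a path: an edge together with the position of one of its targets. -/
abbrev Step (t : HyperGraph Sg p) : Type :=
  (e : t.E) × Fin (t.label e).arity

/-- The list of steps is a path from `v` to `w`. -/
def IsPath (t : HyperGraph Sg p) : t.V → List t.Step → t.V → Prop
  | v, [], w => v = w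
  | v, s :: l, w => t.src s.1 = v ∧ t.IsPath (t.tgt s.1 s.2) l w

/-- Each vertex is the target of a unique path from the root. -/
def IsTree (t : HyperGraph Sg p) : Prop :=
  ∀ v : t.V, ∃! l : List t.Step, t.IsPath t.root l v

theorem isPath_append_singleton (t : HyperGraph Sg p) (s : t.Step) (w : t.V) :
    ∀ (l : List t.Step) (v : t.V),
      t.IsPath v (l ++ [s]) w ↔ t.IsPath v l (t.src s.1) ∧ t.tgt s.1 s.2 = w
  | [], v => by simp [IsPath, eq_comm]
  | a :: l, v => by
      simp [IsPath, isPath_append_singleton t s w l, and_assoc]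

/-- A local criterion: the root is not a target, no vertex is a target in two ways, and all
vertices are accessible from the root. -/
theorem isTree_iff (t : HyperGraph Sg p) :
    t.IsTree ↔ (∀ e i, t.tgt e i ≠ t.root) ∧
      (∀ e i e' i', t.tgt e i = t.tgt e' i' → e = e' ∧ (i : ℕ) = i') ∧
      (∀ P : t.V → Prop, P t.root → (∀ e i, P (t.src e) → P (t.tgt e i)) → ∀ v, P v) := by
  constructor
  · intro h
    refine ⟨?_, ?_, ?_⟩
    · intro e i hr
      obtain ⟨l, hl, -⟩ := h (t.src e)
      have h1 : t.IsPath t.root (l ++ [⟨e, i⟩]) t.root :=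
        (t.isPath_append_singleton _ _ _ _).2 ⟨hl, hr⟩
      have h2 : t.IsPath t.root [] t.root := rfl
      have h3 := (h t.root).unique h1 h2
      simp at h3
    · intro e i e' i' hr
      obtain ⟨l, hl, -⟩ := h (t.src e)
      obtain ⟨l', hl', -⟩ := h (t.src e')
      have h1 : t.IsPath t.root (l ++ [⟨e, i⟩]) (t.tgt e' i') :=
        (t.isPath_append_singleton _ _ _ _).2 ⟨hl, hr⟩
      have h2 : t.IsPath t.root (l' ++ [⟨e', i'⟩]) (t.tgt e' i') :=
        (t.isPath_append_singleton _ _ _ _).2 ⟨hl', rfl⟩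
      have h3 := (h _).unique h1 h2
      have h4 : (⟨e, i⟩ : t.Step) = ⟨e', i'⟩ := by
        have := congrArg List.getLast? h3
        simpa using this
      cases h4
      exact ⟨rfl, rfl⟩
    · intro P h0 h1 v
      have key : ∀ l : List t.Step, ∀ v w, P v → t.IsPath v l w → P w := by
        intro l
        induction l with
        | nil => intro v w hv hp; cases hp; exact hv
        | cons s l ih =>
          rintro v w hv ⟨rfl, hp⟩
          exact ih _ _ (h1 _ _ hv) hp
      obtain ⟨l, hl, -⟩ := h v
      exact key l _ _ h0 hl
  · rintro ⟨h1, h2, h3⟩ v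
    have ex : ∃ l, t.IsPath t.root l v := by
      refine h3 (fun v => ∃ l, t.IsPath t.root l v) ⟨[], rfl⟩ ?_ v
      rintro e i ⟨l, hl⟩
      exact ⟨l ++ [⟨e, i⟩], (t.isPath_append_singleton _ _ _ _).2 ⟨hl, rfl⟩⟩
    obtain ⟨l, hl⟩ := ex
    refine ⟨l, hl, ?_⟩
    intro l' hl'
    induction l using List.reverseRecOn generalizing v l' with
    | nil =>
      cases hl
      rcases List.eq_nil_or_concat' l' with rfl | ⟨m, s, rfl⟩
      · rfl
      · exact absurd ((t.isPath_append_singleton _ _ _ _).1 hl').2 (h1 _ _)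
    | append_singleton l s ih =>
      obtain ⟨ha, rfl⟩ := (t.isPath_append_singleton _ _ _ _).1 hl
      rcases List.eq_nil_or_concat' l' with rfl | ⟨m, s', rfl⟩
      · exact absurd (Eq.symm hl') (h1 _ _)
      · obtain ⟨hb, hc⟩ := (t.isPath_append_singleton _ _ _ _).1 hl'
        obtain ⟨e, i⟩ := s
        obtain ⟨e', i'⟩ := s'
        obtain ⟨rfl, hi⟩ := h2 _ _ _ _ hc
        obtain rfl := Fin.ext hi
        rw [ih _ ha _ hb]

end HyperGraph

/-- A synchronization tree `1 → p` over the ranked set `Sg`. -/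
structure SyncTree (Sg : ℕ → Type u) (p : ℕ) extends HyperGraph Sg p where
  countable_V : Countable V
  countable_E : Countable E
  isTree : toHyperGraph.IsTree

namespace SyncTree

attribute [instance] SyncTree.countable_V SyncTree.countable_E

variable {Sg : ℕ → Type u} {p q : ℕ}

/-- A synchronization tree is finite if its set of edges is finite. -/
def IsFinite (t : SyncTree Sg p) : Prop := Finite t.E

/-- `R` is a simulation `t → t'`: it relates the roots, and whenever `v R v'`, each edge
`v → (v_1, …, v_n)` of `t` is matched by an equally labelled edge `v' → (v_1', …, v_n')` of `t'` with
`v_i R v_i'` for all `i`. -/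
def IsSimulation (t t' : SyncTree Sg p) (R : t.V → t'.V → Prop) : Prop :=
  R t.root t'.root ∧
    ∀ (e : t.E) (v' : t'.V), R (t.src e) v' →
      ∃ e' : t'.E, t'.src e' = v' ∧ t'.label e' = t.label e ∧
        ∀ (i : Fin (t.label e).arity) (i' : Fin (t'.label e').arity), (i : ℕ) = i' →
          R (t.tgt e i) (t'.tgt e' i')

/-- There is a simulation `t → t'`. -/
def Simulated (t t' : SyncTree Sg p) : Prop :=
  ∃ R : t.V → t'.V → Prop, IsSimulation t t' R

theorem Simulated.refl (t : SyncTree Sg p) : Simulated t t := by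
  refine ⟨Eq, rfl, ?_⟩
  rintro e _ rfl
  refine ⟨e, rfl, rfl, ?_⟩
  intro i i' h
  rw [Fin.ext h]

theorem Simulated.trans {t t' t'' : SyncTree Sg p} (h : Simulated t t') (h' : Simulated t' t'') :
    Simulated t t'' := by
  obtain ⟨R, hR, hR'⟩ := h
  obtain ⟨S, hS, hS'⟩ := h'
  refine ⟨fun v w => ∃ x, R v x ∧ S x w, ⟨_, hR, hS⟩, ?_⟩
  rintro e w ⟨x, hx, hw⟩
  obtain ⟨e', rfl, hl, ht⟩ := hR' e x hx
  obtain ⟨e'', rfl, hl', ht'⟩ := hS' e' w hw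
  refine ⟨e'', rfl, hl'.trans hl, ?_⟩
  intro i i'' hi
  have hlt : (i : ℕ) < (t'.label e').arity := by rw [hl]; exact i.2
  exact ⟨t'.tgt e' ⟨i, hlt⟩, ht i ⟨i, hlt⟩ rfl, ht' ⟨i, hlt⟩ i'' hi⟩

/-- The tree `0 : 1 → p` without edges. -/
def zero (Sg : ℕ → Type u) (p : ℕ) : SyncTree Sg p where
  V := Unit
  E := Empty
  root := ()
  src := Empty.elim
  label := Empty.elim
  tgt e := e.elim
  countable_V := inferInstance
  countable_E := inferInstance
  isTree := (HyperGraph.isTree_iff _).2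
    ⟨fun e => e.elim, fun e => e.elim, fun _ h _ _ => h⟩

/-- The tree `1 → p` with a single edge, labelled `ex_i`. -/
def exit (Sg : ℕ → Type u) {p : ℕ} (i : Fin p) : SyncTree Sg p where
  V := Unit
  E := Unit
  root := ()
  src _ := ()
  label _ := .exit i
  tgt _ j := Fin.elim0 j
  countable_V := inferInstance
  countable_E := inferInstance
  isTree := (HyperGraph.isTree_iff _).2
    ⟨fun _ j => Fin.elim0 j, fun _ j => Fin.elim0 j, fun _ h _ _ => h⟩

/-- The labels of the edges of the tree `letter σ`. -/
def letterLabel {k : ℕ} (σ : Sg k) : Option (Fin k) → Label Sg k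
  | none => .letter k σ
  | some i => .exit i

/-- The targets of the edges of the tree `letter σ`. -/
def letterTgt {k : ℕ} (σ : Sg k) :
    (e : Option (Fin k)) → Fin (letterLabel σ e).arity → Option (Fin k)
  | none => fun j => some j
  | some _ => fun j => Fin.elim0 j

/-- The tree `1 → k` of a letter `σ` of rank `k`: one edge `root → (v_1, …, v_k)` labelled `σ`, and
for each `i` one edge with source `v_i`, labelled `ex_i`.  The root and the edge labelled `σ` are
`none`, and `v_i` and the edge with source `v_i` are `some i`. -/
def letter {k : ℕ} (σ : Sg k) : SyncTree Sg k where
  V := Option (Fin k)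
  E := Option (Fin k)
  root := none
  src := id
  label := letterLabel σ
  tgt := letterTgt σ
  countable_V := inferInstance
  countable_E := inferInstance
  isTree := by
    refine (HyperGraph.isTree_iff _).2 ⟨?_, ?_, ?_⟩
    · rintro (_ | i) j
      · exact Option.some_ne_none _
      · exact Fin.elim0 j
    · rintro (_ | i) j (_ | i') j' h
      · exact ⟨rfl, congrArg Fin.val (Option.some_injective _ h)⟩
      · exact Fin.elim0 j'
      · exact Fin.elim0 j
      · exact Fin.elim0 j
    · rintro P h0 h1 (_ | i)
      · exact h0
      · exact h1 none i h0

/-- The vertices other than the root. -/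
abbrev NonRoot (t : SyncTree Sg p) : Type := {v : t.V // v ≠ t.root}

open Classical in
/-- The canonical map of a vertex set into a set in which the root is replaced by `r` and the other
vertices by a copy under `f`. -/
noncomputable def glue (t : SyncTree Sg p) {X : Type} (r : X) (f : t.NonRoot → X) (v : t.V) : X :=
  if h : v = t.root then r else f ⟨v, h⟩

theorem glue_root (t : SyncTree Sg p) {X : Type} (r : X) (f : t.NonRoot → X) :
    t.glue r f t.root = r := by
  simp [glue]

theorem glue_ne (t : SyncTree Sg p) {X : Type} (r : X) (f : t.NonRoot → X) {v : t.V}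
    (h : v ≠ t.root) : t.glue r f v = f ⟨v, h⟩ := by
  simp [glue, h]

theorem tgt_ne_root (t : SyncTree Sg p) (e : t.E) (i : Fin (t.label e).arity) :
    t.tgt e i ≠ t.root :=
  ((HyperGraph.isTree_iff _).1 t.isTree).1 e i

theorem tgt_inj (t : SyncTree Sg p) {e e' : t.E} {i : Fin (t.label e).arity}
    {i' : Fin (t.label e').arity} (h : t.tgt e i = t.tgt e' i') : e = e' ∧ (i : ℕ) = i' :=
  ((HyperGraph.isTree_iff _).1 t.isTree).2.1 e i e' i' h

theorem vertex_induction (t : SyncTree Sg p) {P : t.V → Prop} (h0 : P t.root)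
    (h1 : ∀ e i, P (t.src e) → P (t.tgt e i)) (v : t.V) : P v :=
  ((HyperGraph.isTree_iff _).1 t.isTree).2.2 P h0 h1 v

/-! #### Sum -/

/-- Vertices of the sum: a common root, and disjoint copies of the other vertices. -/
abbrev AddV (t t' : SyncTree Sg p) : Type := Option (t.NonRoot ⊕ t'.NonRoot)

/-- The first summand inside the sum. -/
noncomputable def addInl (t t' : SyncTree Sg p) : t.V → AddV t t' :=
  t.glue none (fun v => some (.inl v))

/-- The second summand inside the sum. -/
noncomputable def addInr (t t' : SyncTree Sg p) : t'.V → AddV t t' :=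
  t'.glue none (fun v => some (.inr v))

/-- The labels of the edges of the sum. -/
def addLabel (t t' : SyncTree Sg p) : t.E ⊕ t'.E → Label Sg p
  | .inl e => t.label e
  | .inr e => t'.label e

/-- The targets of the edges of the sum. -/
noncomputable def addTgt (t t' : SyncTree Sg p) :
    (e : t.E ⊕ t'.E) → Fin (addLabel t t' e).arity → AddV t t'
  | .inl e => fun i => addInl t t' (t.tgt e i)
  | .inr e => fun i => addInr t t' (t'.tgt e i)

/-- The sum `t + t'`: the disjoint union of `t` and `t'` with the roots merged. -/
noncomputable def add (t t' : SyncTree Sg p) : SyncTree Sg p where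
  V := AddV t t'
  E := t.E ⊕ t'.E
  root := none
  src := Sum.elim (fun e => addInl t t' (t.src e)) (fun e => addInr t t' (t'.src e))
  label := addLabel t t'
  tgt := addTgt t t'
  countable_V := inferInstance
  countable_E := inferInstance
  isTree := by
    refine (HyperGraph.isTree_iff _).2 ⟨?_, ?_, ?_⟩
    · rintro (e | e) i
      · simp [addTgt, addInl, glue_ne _ _ _ (t.tgt_ne_root e i)]
      · simp [addTgt, addInr, glue_ne _ _ _ (t'.tgt_ne_root e i)]
    · rintro (e | e) i (e' | e') i' h
      · simp only [addTgt, addInl, glue_ne _ _ _ (t.tgt_ne_root e i),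
          glue_ne _ _ _ (t.tgt_ne_root e' i'), Option.some.injEq, Sum.inl.injEq,
          Subtype.mk.injEq] at h
        obtain ⟨rfl, h⟩ := t.tgt_inj h
        exact ⟨rfl, h⟩
      · simp [addTgt, addInl, addInr, glue_ne _ _ _ (t.tgt_ne_root e i),
          glue_ne _ _ _ (t'.tgt_ne_root e' i')] at h
      · simp [addTgt, addInl, addInr, glue_ne _ _ _ (t'.tgt_ne_root e i),
          glue_ne _ _ _ (t.tgt_ne_root e' i')] at h
      · simp only [addTgt, addInr, glue_ne _ _ _ (t'.tgt_ne_root e i),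
          glue_ne _ _ _ (t'.tgt_ne_root e' i'), Option.some.injEq, Sum.inr.injEq,
          Subtype.mk.injEq] at h
        obtain ⟨rfl, h⟩ := t'.tgt_inj h
        exact ⟨rfl, h⟩
    · intro P h0 h1 v
      have hl : ∀ v, P (addInl t t' v) := by
        refine t.vertex_induction ?_ ?_
        · rw [addInl, glue_root]; exact h0
        · intro e i h; exact h1 (.inl e) i h
      have hr : ∀ v, P (addInr t t' v) := by
        refine t'.vertex_induction ?_ ?_
        · rw [addInr, glue_root]; exact h0
        · intro e i h; exact h1 (.inr e) i h
      rcases v with _ | (v | v)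
      · exact h0
      · have := hl v.1
        rwa [addInl, glue_ne _ _ _ v.2] at this
      · have := hr v.1
        rwa [addInr, glue_ne _ _ _ v.2] at this

/-! #### Composition -/

/-- The edges of `t` labelled `ex_i`. -/
abbrev ExitEdge (t : SyncTree Sg p) (i : Fin p) : Type := {e : t.E // t.label e = .exit i}

/-- Vertices of the composite: those of `t`, and, for each edge of `t` labelled `ex_i`, a copy of
the vertices of `s i` other than the root. -/
abbrev CompV (t : SyncTree Sg p) (s : Fin p → SyncTree Sg q) : Type :=
  t.V ⊕ ((i : Fin p) × t.ExitEdge i × (s i).NonRoot)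

/-- Edges of the composite: the edges of `t` labelled by letters, and, for each edge of `t` labelled
`ex_i`, a copy of the edges of `s i`. -/
abbrev CompE (t : SyncTree Sg p) (s : Fin p → SyncTree Sg q) : Type :=
  {e : t.E // (t.label e).IsLetter} ⊕ ((i : Fin p) × t.ExitEdge i × (s i).E)

/-- The copy of `s i` inside the composite that replaces the edge `e` labelled `ex_i`; its root is
the source of `e`. -/
noncomputable def compIn (t : SyncTree Sg p) (s : Fin p → SyncTree Sg q) (i : Fin p)
    (e : t.ExitEdge i) : (s i).V → CompV t s :=
  (s i).glue (.inl (t.src e.1)) (fun v => .inr ⟨i, e, v⟩)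

/-- The labels of the edges of the composite. -/
def compLabel (t : SyncTree Sg p) (s : Fin p → SyncTree Sg q) : CompE t s → Label Sg q
  | .inl e => (t.label e.1).relabel q e.2
  | .inr x => (s x.1).label x.2.2

/-- The targets of the edges of the composite. -/
noncomputable def compTgt (t : SyncTree Sg p) (s : Fin p → SyncTree Sg q) :
    (e : CompE t s) → Fin (compLabel t s e).arity → CompV t s
  | .inl e => fun j => .inl (t.tgt e.1 (Fin.cast (Label.arity_relabel _ e.2) j))
  | .inr x => fun j => compIn t s x.1 x.2.1 ((s x.1).tgt x.2.2 j)

/-- The composite `t · (s_1, …, s_p)`: each edge of `t` labelled `ex_i` is replaced by a copy of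
`s i`, whose root becomes the source of this edge. -/
noncomputable def comp (t : SyncTree Sg p) (s : Fin p → SyncTree Sg q) : SyncTree Sg q where
  V := CompV t s
  E := CompE t s
  root := .inl t.root
  src := Sum.elim (fun e => .inl (t.src e.1)) (fun x => compIn t s x.1 x.2.1 ((s x.1).src x.2.2))
  label := compLabel t s
  tgt := compTgt t s
  countable_V := inferInstance
  countable_E := inferInstance
  isTree := by
    refine (HyperGraph.isTree_iff _).2 ⟨?_, ?_, ?_⟩
    · rintro (e | ⟨i, e, f⟩) j
      · intro h
        exact t.tgt_ne_root _ _ (Sum.inl_injective h)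
      · simp [compTgt, compIn, glue_ne _ _ _ ((s i).tgt_ne_root f j)]
    · rintro (⟨e, he⟩ | ⟨i, e, f⟩) j (⟨e', he'⟩ | ⟨i', e', f'⟩) j' h
      · obtain ⟨rfl, h⟩ := t.tgt_inj (Sum.inl_injective h)
        exact ⟨rfl, h⟩
      · simp [compTgt, compIn, glue_ne _ _ _ ((s i').tgt_ne_root f' j')] at h
      · simp [compTgt, compIn, glue_ne _ _ _ ((s i).tgt_ne_root f j)] at h
      · simp only [compTgt, compIn, glue_ne _ _ _ ((s i).tgt_ne_root f j),
          glue_ne _ _ _ ((s i').tgt_ne_root f' j'), Sum.inr.injEq, Sigma.mk.injEq] at h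
        obtain ⟨rfl, h⟩ := h
        simp only [heq_eq_eq, Prod.mk.injEq, Subtype.mk.injEq] at h
        obtain ⟨rfl, h⟩ := h
        obtain ⟨rfl, h⟩ := (s i).tgt_inj h
        exact ⟨rfl, h⟩
    · intro P h0 h1 v
      have hl : ∀ v, P (.inl v) := by
        refine t.vertex_induction h0 ?_
        intro e i h
        cases hle : t.label e with
        | exit i' =>
          have h2 : (t.label e).arity = 0 := by rw [hle]; rfl
          have h3 := i.2
          omega
        | letter k σ =>
          have he : (t.label e).IsLetter := by rw [hle]; trivial
          exact h1 (.inl ⟨e, he⟩) (Fin.cast (Label.arity_relabel (q := q) _ he).symm i) h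
      have hr : ∀ i e v, P (compIn t s i e v) := by
        intro i e
        refine (s i).vertex_induction ?_ ?_
        · rw [compIn, glue_root]; exact hl _
        · intro f j h; exact h1 (.inr ⟨i, e, f⟩) j h
      rcases v with v | ⟨i, e, v⟩
      · exact hl v
      · have := hr i e v.1
        rwa [compIn, glue_ne _ _ _ v.2] at this

/-! #### Finiteness and simulations of sums and composites -/

theorem isFinite_zero : (zero Sg p).IsFinite := by
  change Finite Empty; infer_instance

theorem isFinite_exit (i : Fin p) : (exit Sg i).IsFinite := by
  change Finite Unit; infer_instance

theorem isFinite_letter {k : ℕ} (σ : Sg k) : (letter σ).IsFinite := by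
  change Finite (Option (Fin k)); infer_instance

theorem IsFinite.add {t t' : SyncTree Sg p} (h : t.IsFinite) (h' : t'.IsFinite) :
    (t.add t').IsFinite := by
  have : Finite t.E := h
  have : Finite t'.E := h'
  change Finite (t.E ⊕ t'.E); infer_instance

theorem IsFinite.comp {t : SyncTree Sg p} {s : Fin p → SyncTree Sg q} (h : t.IsFinite)
    (h' : ∀ i, (s i).IsFinite) : (t.comp s).IsFinite := by
  have : Finite t.E := h
  have : ∀ i, Finite (s i).E := h'
  change Finite (CompE t s); infer_instance

theorem Simulated.add {t t' s s' : SyncTree Sg p} (h : Simulated t t') (h' : Simulated s s') :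
    Simulated (t.add s) (t'.add s') := by
  obtain ⟨R, hR, hR'⟩ := h
  obtain ⟨S, hS, hS'⟩ := h'
  refine ⟨fun x x' => (x = none ∧ x' = none) ∨
    (∃ v v', x = some (.inl v) ∧ x' = addInl t' s' v' ∧ R v.1 v') ∨
    (∃ v v', x = some (.inr v) ∧ x' = addInr t' s' v' ∧ S v.1 v'), Or.inl ⟨rfl, rfl⟩, ?_⟩
  rintro (e | e) x' hx
  · have key : ∃ v', x' = addInl t' s' v' ∧ R (t.src e) v' := by
      change (addInl t s (t.src e) = none ∧ _) ∨ (∃ v v', addInl t s (t.src e) = _ ∧ _) ∨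
        (∃ v v', addInl t s (t.src e) = _ ∧ _) at hx
      by_cases hr : t.src e = t.root
      · simp only [addInl, hr, glue_root] at hx
        simp only [reduceCtorEq, false_and, exists_false, or_false, true_and] at hx
        exact ⟨t'.root, by rw [hx, addInl, glue_root], by rw [hr]; exact hR⟩
      · simp only [addInl, glue_ne _ _ _ hr] at hx
        simp only [reduceCtorEq, false_and, exists_false, or_false, false_or,
          Option.some.injEq, Sum.inl.injEq] at hx
        obtain ⟨v, v', rfl, h1, h2⟩ := hx
        exact ⟨v', h1, h2⟩
    obtain ⟨v', rfl, hv⟩ := key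
    obtain ⟨e', rfl, hl, ht⟩ := hR' e v' hv
    refine ⟨.inl e', rfl, hl, ?_⟩
    intro i i' hi
    refine Or.inr (Or.inl ⟨⟨t.tgt e i, t.tgt_ne_root e i⟩, t'.tgt e' i', ?_, rfl, ht i i' hi⟩)
    exact glue_ne t (X := AddV t s) none (fun v => some (.inl v)) (t.tgt_ne_root e i)
  · have key : ∃ v', x' = addInr t' s' v' ∧ S (s.src e) v' := by
      change (addInr t s (s.src e) = none ∧ _) ∨ (∃ v v', addInr t s (s.src e) = _ ∧ _) ∨
        (∃ v v', addInr t s (s.src e) = _ ∧ _) at hx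
      by_cases hr : s.src e = s.root
      · simp only [addInr, hr, glue_root] at hx
        simp only [reduceCtorEq, false_and, exists_false, or_false, true_and] at hx
        exact ⟨s'.root, by rw [hx, addInr, glue_root], by rw [hr]; exact hS⟩
      · simp only [addInr, glue_ne _ _ _ hr] at hx
        simp only [reduceCtorEq, false_and, exists_false, false_or,
          Option.some.injEq, Sum.inr.injEq] at hx
        obtain ⟨v, v', rfl, h1, h2⟩ := hx
        exact ⟨v', h1, h2⟩
    obtain ⟨v', rfl, hv⟩ := key
    obtain ⟨e', rfl, hl, ht⟩ := hS' e v' hv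
    refine ⟨.inr e', rfl, hl, ?_⟩
    intro i i' hi
    refine Or.inr (Or.inr ⟨⟨s.tgt e i, s.tgt_ne_root e i⟩, s'.tgt e' i', ?_, rfl, ht i i' hi⟩)
    exact glue_ne s (X := AddV t s) none (fun v => some (.inr v)) (s.tgt_ne_root e i)

theorem relabel_congr : ∀ {l l' : Label Sg p} (h : l.IsLetter) (h' : l'.IsLetter), l' = l →
    l'.relabel q h' = l.relabel q h
  | _, _, _, _, rfl => rfl

theorem Simulated.comp {t t' : SyncTree Sg p} {s s' : Fin p → SyncTree Sg q}
    (h : Simulated t t') (h' : ∀ i, Simulated (s i) (s' i)) :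
    Simulated (t.comp s) (t'.comp s') := by
  obtain ⟨R, hR, hR'⟩ := h
  choose S hS hS' using h'
  refine ⟨fun x x' => (∃ v v', x = .inl v ∧ x' = .inl v' ∧ R v v') ∨
    (∃ i e e' w w', x = .inr ⟨i, e, w⟩ ∧ x' = compIn t' s' i e' w' ∧ S i w.1 w'),
    Or.inl ⟨_, _, rfl, rfl, hR⟩, ?_⟩
  rintro (⟨e, he⟩ | ⟨i, e, f⟩) x' hx
  · change (∃ v v', Sum.inl (t.src e) = _ ∧ _) ∨ (∃ i e' e'' w w', Sum.inl (t.src e) = _ ∧ _) at hx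
    simp only [reduceCtorEq, false_and, exists_false, or_false, Sum.inl.injEq] at hx
    obtain ⟨v, v', rfl, rfl, hv⟩ := hx
    obtain ⟨e', rfl, hl, ht⟩ := hR' e v' hv
    have he' : (t'.label e').IsLetter := by rw [hl]; exact he
    refine ⟨.inl ⟨e', he'⟩, rfl, relabel_congr he he' hl, ?_⟩
    intro j j' hj
    exact Or.inl ⟨_, _, rfl, rfl, ht _ _ hj⟩
  · have key : ∃ e' w', x' = compIn t' s' i e' w' ∧ S i ((s i).src f) w' := by
      change (∃ v v', compIn t s i e ((s i).src f) = _ ∧ _) ∨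
        (∃ i' e' e'' w w', compIn t s i e ((s i).src f) = _ ∧ _) at hx
      by_cases hr : (s i).src f = (s i).root
      · simp only [compIn, hr, glue_root] at hx
        simp only [reduceCtorEq, false_and, exists_false, or_false, Sum.inl.injEq] at hx
        obtain ⟨v, v', rfl, rfl, hv⟩ := hx
        obtain ⟨e', rfl, hl, -⟩ := hR' e.1 v' hv
        refine ⟨⟨e', hl.trans e.2⟩, (s' i).root, ?_, by rw [hr]; exact hS i⟩
        rw [compIn, glue_root]
      · rcases hx with ⟨v, v', h1, -⟩ | ⟨i', e', e'', w, w', h1, h2, h3⟩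
        · simp [compIn, glue_ne _ _ _ hr] at h1
        · simp only [compIn, glue_ne _ _ _ hr, Sum.inr.injEq, Sigma.mk.injEq] at h1
          obtain ⟨rfl, h1⟩ := h1
          simp only [heq_eq_eq, Prod.mk.injEq] at h1
          obtain ⟨rfl, rfl⟩ := h1
          exact ⟨e'', w', h2, h3⟩
    obtain ⟨e', w', rfl, hw⟩ := key
    obtain ⟨f', rfl, hl, ht⟩ := hS' i f w' hw
    refine ⟨.inr ⟨i, e', f'⟩, rfl, hl, ?_⟩
    intro j j' hj
    refine Or.inr ⟨i, e, e', ⟨(s i).tgt f j, (s i).tgt_ne_root f j⟩, (s' i).tgt f' j', ?_, rfl,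
      ht j j' hj⟩
    exact glue_ne (s i) (X := CompV t s) (.inl (t.src e.1)) (fun v => .inr ⟨i, e, v⟩) ((s i).tgt_ne_root f j)

end SyncTree

/-! ### Finite synchronization trees modulo simulation equivalence -/

/-- Finite synchronization trees `n → p` over `Sg`: `n`-tuples of finite synchronization trees
`1 → p`. -/
abbrev FST (Sg : ℕ → Type u) (n p : ℕ) : Type (max u 1) :=
  Fin n → {t : SyncTree Sg p // t.IsFinite}

namespace FST

variable {Sg : ℕ → Type u} {n p q : ℕ}

/-- There is a simulation `t → t'`, that is, an `n`-tuple of simulations between the components. -/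
def Simulated (t t' : FST Sg n p) : Prop :=
  ∀ i, SyncTree.Simulated (t i).1 (t' i).1

/-- Simulation equivalence. -/
instance simEquiv (Sg : ℕ → Type u) (n p : ℕ) : Setoid (FST Sg n p) where
  r t t' := Simulated t t' ∧ Simulated t' t
  iseqv :=
    { refl := fun _ => ⟨fun _ => .refl _, fun _ => .refl _⟩
      symm := fun h => ⟨h.2, h.1⟩
      trans := fun h h' => ⟨fun i => (h.1 i).trans (h'.1 i), fun i => (h'.2 i).trans (h.2 i)⟩ }

/-- Composition of tuples of finite trees. -/
noncomputable def comp (t : FST Sg n p) (s : FST Sg p q) : FST Sg n q :=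
  fun i => ⟨(t i).1.comp fun j => (s j).1, (t i).2.comp fun j => (s j).2⟩

/-- The identities: the tuples `(ex_1, …, ex_n)`. -/
def one (Sg : ℕ → Type u) (n : ℕ) : FST Sg n n :=
  fun i => ⟨.exit Sg i, SyncTree.isFinite_exit i⟩

/-- The distinguished morphisms: the trees `ex_i`. -/
def dist (Sg : ℕ → Type u) {n : ℕ} (i : Fin n) : FST Sg 1 n :=
  fun _ => ⟨.exit Sg i, SyncTree.isFinite_exit i⟩

/-- The componentwise sum. -/
noncomputable def add (t s : FST Sg n p) : FST Sg n p :=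
  fun i => ⟨(t i).1.add (s i).1, (t i).2.add (s i).2⟩

/-- The tuple of trees without edges. -/
def zero (Sg : ℕ → Type u) (n p : ℕ) : FST Sg n p :=
  fun _ => ⟨.zero Sg p, SyncTree.isFinite_zero⟩

/-- The tree of a letter. -/
def letter {k : ℕ} (σ : Sg k) : FST Sg 1 k :=
  fun _ => ⟨.letter σ, SyncTree.isFinite_letter σ⟩

end FST

/-- The theory `SFST` of simulation equivalence classes of finite synchronization trees over `Sg`,
with the operations induced by those on trees. -/
noncomputable def SFST (Sg : ℕ → Type u) : GroveData.{max u 1} where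
  Hom n p := Quotient (FST.simEquiv Sg n p)
  comp := Quotient.map₂ FST.comp fun _ _ h _ _ h' =>
    ⟨fun i => (h.1 i).comp h'.1, fun i => (h.2 i).comp h'.2⟩
  one n := Quotient.mk _ (FST.one Sg n)
  dist i := Quotient.mk _ (FST.dist Sg i)
  add := Quotient.map₂ FST.add fun _ _ h _ _ h' =>
    ⟨fun i => (h.1 i).add (h'.1 i), fun i => (h.2 i).add (h'.2 i)⟩
  zero n p := Quotient.mk _ (FST.zero Sg n p)

/-- The letters of `Sg`, regarded as morphisms of `SFST`. -/
def SFST.letter {Sg : ℕ → Type u} {k : ℕ} (σ : Sg k) : (SFST Sg).Hom 1 k :=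
  Quotient.mk (FST.simEquiv Sg 1 k) (FST.letter σ)

end GroveTheory

-- The sum of trees is a join for the simulation preorder, so in `SFST` the relation `f ≤ g` says
-- exactly that `f` is simulated by `g` (`le_mk`). The additive axioms then follow from the
-- universal property of joins. Most laws of composition come from explicit maps or relations
-- between vertex sets that carry edges to edges, and monotonicity from the compatibility of
-- simulations with composition.
--
-- For existence of the extension, a finite tree is read as a term. The value at a vertex is the
-- join, over the edges leaving it, of `φ σ` composed with the tuple of values at the targets, or of
-- `T.dist i` for an edge labelled `ex_i`. In an ordered theory values grow along simulations
-- (`eval_le_eval`), so simulation equivalent trees have equal values. Since values are determined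
-- by their recursive description (`eq_eval`), guessing the values on sums and composites proves
-- `eval_add` and `eval_comp`, and the value is a morphism (`lift`).
--
-- For uniqueness, evaluating a tree in `SFST` itself, with letters as their own classes, returns
-- the class of the tree (`eval_gen_root`). Morphisms commute with evaluation (`map_eval`), so a
-- morphism out of `SFST` is determined by the images of the letters.
--
-- Simulations are allowed to start at arbitrary vertices (`Sim`), which permits induction over
-- vertices without constructing subtrees. At the roots, `Sim` unfolds to the same proposition as
-- `Simulated`.

universe w'

namespace GroveTheory

namespace SyncTree

variable {Sg : ℕ → Type u} {p q m : ℕ}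

/-! ### Simulations between pointed trees -/

/-- The edge `e` is matched by the edge `e'`, with targets related by `R`. -/
def Matches {t t' : SyncTree Sg p} (R : t.V → t'.V → Prop) (e : t.E) (e' : t'.E) : Prop :=
  t'.label e' = t.label e ∧
    ∀ (i : Fin (t.label e).arity) (i' : Fin (t'.label e').arity), (i : ℕ) = i' →
      R (t.tgt e i) (t'.tgt e' i')

/-- Some relation with the transfer property of simulations relates `v` and `v'`. -/
def Sim (t t' : SyncTree Sg p) (v : t.V) (v' : t'.V) : Prop :=
  ∃ R : t.V → t'.V → Prop, R v v' ∧
    ∀ (e : t.E) (v' : t'.V), R (t.src e) v' → ∃ e' : t'.E, t'.src e' = v' ∧ Matches R e e'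

theorem Matches.mono {t t' : SyncTree Sg p} {R S : t.V → t'.V → Prop} (h : ∀ v v', R v v' → S v v')
    {e : t.E} {e' : t'.E} (H : Matches R e e') : Matches S e e' :=
  ⟨H.1, fun i i' hi => h _ _ (H.2 i i' hi)⟩

/-- `Sim` is the union of all relations with the transfer property, hence has that property itself:
it is the largest one. -/
theorem Sim.exists_matches {t t' : SyncTree Sg p} {e : t.E} {v' : t'.V}
    (h : Sim t t' (t.src e) v') : ∃ e' : t'.E, t'.src e' = v' ∧ Matches (Sim t t') e e' := by
  obtain ⟨R, hR, hR'⟩ := h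
  obtain ⟨e', h, H⟩ := hR' e v' hR
  exact ⟨e', h, H.mono fun v v' hv => ⟨R, hv, hR'⟩⟩

/-- Coinduction up to `Sim`. -/
theorem Sim.coinduct {t t' : SyncTree Sg p} (R : t.V → t'.V → Prop)
    (hR : ∀ (e : t.E) (v' : t'.V), R (t.src e) v' →
      ∃ e' : t'.E, t'.src e' = v' ∧ Matches (fun v v' => R v v' ∨ Sim t t' v v') e e')
    {v : t.V} {v' : t'.V} (h : R v v') : Sim t t' v v' := by
  refine ⟨fun v v' => R v v' ∨ Sim t t' v v', Or.inl h, ?_⟩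
  rintro e v' (h | h)
  · exact hR e v' h
  · obtain ⟨e', h, H⟩ := h.exists_matches
    exact ⟨e', h, H.mono fun _ _ => Or.inr⟩

theorem Sim.intro {t t' : SyncTree Sg p} {v : t.V} {v' : t'.V}
    (h : ∀ e, t.src e = v → ∃ e' : t'.E, t'.src e' = v' ∧ Matches (Sim t t') e e') :
    Sim t t' v v' := by
  refine Sim.coinduct (fun x x' => x = v ∧ x' = v') ?_ ⟨rfl, rfl⟩
  rintro e _ ⟨he, rfl⟩
  obtain ⟨e', h, H⟩ := h e he
  exact ⟨e', h, H.mono fun _ _ => Or.inr⟩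

/-- The graph of a vertex map is a simulation as soon as each edge has a matching image edge. This
is the form used for most tree identities. -/
theorem Sim.of_map {t t' : SyncTree Sg p} (f : t.V → t'.V)
    (hf : ∀ e : t.E, ∃ e' : t'.E, t'.src e' = f (t.src e) ∧ Matches (fun v v' => f v = v') e e')
    (v : t.V) : Sim t t' v (f v) := by
  refine ⟨fun v v' => f v = v', rfl, ?_⟩
  rintro e _ rfl
  exact hf e

theorem Sim.refl (t : SyncTree Sg p) (v : t.V) : Sim t t v v := by
  refine Sim.of_map id (fun e => ⟨e, rfl, rfl, ?_⟩) v
  intro i i' h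
  rw [Fin.ext h]; rfl

theorem Matches.trans {t t' t'' : SyncTree Sg p} {R : t.V → t'.V → Prop} {S : t'.V → t''.V → Prop}
    {Q : t.V → t''.V → Prop} (h : ∀ x y z, R x y → S y z → Q x z) {e : t.E} {e' : t'.E} {e'' : t''.E}
    (H : Matches R e e') (H' : Matches S e' e'') : Matches Q e e'' := by
  refine ⟨H'.1.trans H.1, fun i i'' hi => ?_⟩
  have hlt : (i : ℕ) < (t'.label e').arity := by rw [H.1]; exact i.2
  exact h _ _ _ (H.2 i ⟨i, hlt⟩ rfl) (H'.2 ⟨i, hlt⟩ i'' hi)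

theorem Sim.trans {t t' t'' : SyncTree Sg p} {v : t.V} {v' : t'.V} {v'' : t''.V}
    (h : Sim t t' v v') (h' : Sim t' t'' v' v'') : Sim t t'' v v'' := by
  refine ⟨fun v v'' => ∃ v', Sim t t' v v' ∧ Sim t' t'' v' v'', ⟨_, h, h'⟩, ?_⟩
  rintro e w ⟨x, hx, hw⟩
  obtain ⟨e', rfl, H⟩ := hx.exists_matches
  obtain ⟨e'', rfl, H'⟩ := hw.exists_matches
  exact ⟨e'', rfl, H.trans (fun x y z hx hy => ⟨y, hx, hy⟩) H'⟩

theorem matches_of_eq {t t' : SyncTree Sg p} {R : t.V → t'.V → Prop} {e : t.E} {e' : t'.E}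
    (hl : t.label e = t'.label e')
    (h : ∀ i, R (t.tgt e i) (t'.tgt e' (Fin.cast (congrArg Label.arity hl) i))) :
    Matches R e e' := by
  refine ⟨hl.symm, fun i i' hi => ?_⟩
  have := h i
  rwa [show i' = Fin.cast (congrArg Label.arity hl) i from Fin.ext hi.symm]

/-! ### The sum is a join -/

theorem sim_addInl (t t' : SyncTree Sg p) (v : t.V) : Sim t (t.add t') v (addInl t t' v) :=
  Sim.of_map (t' := t.add t') _ (fun e => ⟨.inl e, rfl, matches_of_eq rfl fun _ => rfl⟩) v

theorem sim_addInr (t t' : SyncTree Sg p) (v : t'.V) : Sim t' (t.add t') v (addInr t t' v) :=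
  Sim.of_map (t' := t.add t') _ (fun e => ⟨.inr e, rfl, matches_of_eq rfl fun _ => rfl⟩) v

theorem sim_add_left (t t' : SyncTree Sg p) : Sim t (t.add t') t.root (t.add t').root := by
  have := sim_addInl t t' t.root
  rwa [addInl, glue_root] at this

theorem sim_add_right (t t' : SyncTree Sg p) : Sim t' (t.add t') t'.root (t.add t').root := by
  have := sim_addInr t t' t'.root
  rwa [addInr, glue_root] at this

theorem addInl_ne (t t' : SyncTree Sg p) {v : t.V} (h : v ≠ t.root) :
    addInl t t' v = some (.inl ⟨v, h⟩) := glue_ne t _ _ h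

theorem addInr_ne (t t' : SyncTree Sg p) {v : t'.V} (h : v ≠ t'.root) :
    addInr t t' v = some (.inr ⟨v, h⟩) := glue_ne t' _ _ h

theorem addInl_root (t t' : SyncTree Sg p) : addInl t t' t.root = none := glue_root t _ _

theorem addInr_root (t t' : SyncTree Sg p) : addInr t t' t'.root = none := glue_root t' _ _

theorem sim_add {t t' u : SyncTree Sg p} {v : u.V} (h : Sim t u t.root v)
    (h' : Sim t' u t'.root v) : Sim (t.add t') u (t.add t').root v := by
  -- Only the merged root is tied to `v` itself; every other vertex lies in one summand and keeps
  -- the vertices that simulate it there.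
  let R : AddV t t' → u.V → Prop := fun x w =>
    match x with
    | none => w = v
    | some (.inl a) => Sim t u a.1 w
    | some (.inr a) => Sim t' u a.1 w
  have hl : ∀ a w, R (addInl t t' a) w → Sim t u a w := by
    intro a w hw
    by_cases ha : a = t.root
    · subst ha; rw [addInl_root] at hw; cases hw; exact h
    · rwa [addInl_ne _ _ ha] at hw
  have hr : ∀ a w, R (addInr t t' a) w → Sim t' u a w := by
    intro a w hw
    by_cases ha : a = t'.root
    · subst ha; rw [addInr_root] at hw; cases hw; exact h'
    · rwa [addInr_ne _ _ ha] at hw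
  refine ⟨R, rfl, ?_⟩
  rintro (e | e) w hw
  · obtain ⟨e', he', H⟩ := (hl _ _ hw).exists_matches
    refine ⟨e', he', H.1, fun i i' hi => ?_⟩
    change R (addInl t t' (t.tgt e i)) _
    rw [addInl_ne _ _ (t.tgt_ne_root e i)]
    exact H.2 i i' hi
  · obtain ⟨e', he', H⟩ := (hr _ _ hw).exists_matches
    refine ⟨e', he', H.1, fun i i' hi => ?_⟩
    change R (addInr t t' (t'.tgt e i)) _
    rw [addInr_ne _ _ (t'.tgt_ne_root e i)]
    exact H.2 i i' hi

/-- The sum is the least upper bound; associativity, commutativity and idempotence need nothing else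
about it. -/
theorem sim_add_iff {t t' u : SyncTree Sg p} {v : u.V} :
    Sim (t.add t') u (t.add t').root v ↔ Sim t u t.root v ∧ Sim t' u t'.root v :=
  ⟨fun h => ⟨(sim_add_left t t').trans h, (sim_add_right t t').trans h⟩,
    fun h => sim_add h.1 h.2⟩

theorem sim_zero (u : SyncTree Sg p) (v : u.V) : Sim (zero Sg p) u (zero Sg p).root v :=
  Sim.intro fun e => Empty.elim e

/-! ### Laws of composition -/

theorem compIn_root (t : SyncTree Sg p) (s : Fin p → SyncTree Sg q) (i : Fin p)
    (e : t.ExitEdge i) : compIn t s i e (s i).root = .inl (t.src e.1) := glue_root _ _ _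

theorem compIn_ne (t : SyncTree Sg p) (s : Fin p → SyncTree Sg q) (i : Fin p)
    (e : t.ExitEdge i) {v : (s i).V} (h : v ≠ (s i).root) :
    compIn t s i e v = .inr ⟨i, e, ⟨v, h⟩⟩ := glue_ne _ _ _ h

theorem compIn_injective (t : SyncTree Sg p) (s : Fin p → SyncTree Sg q) (i : Fin p)
    (e : t.ExitEdge i) : Function.Injective (compIn t s i e) := by
  intro v w h
  by_cases hv : v = (s i).root <;> by_cases hw : w = (s i).root
  · rw [hv, hw]
  · subst hv; rw [compIn_root, compIn_ne _ _ _ _ hw] at h; cases h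
  · subst hw; rw [compIn_root, compIn_ne _ _ _ _ hv] at h; cases h
  · rw [compIn_ne _ _ _ _ hv, compIn_ne _ _ _ _ hw] at h; cases h; rfl

theorem sim_compIn (t : SyncTree Sg p) (s : Fin p → SyncTree Sg q) (i : Fin p)
    (e : t.ExitEdge i) (v : (s i).V) : Sim (s i) (t.comp s) v (compIn t s i e v) :=
  Sim.of_map (t' := t.comp s) _ (fun f => ⟨.inr ⟨i, e, f⟩, rfl, matches_of_eq rfl fun _ => rfl⟩) v

/-- The composite is just the one copy of `s i`. The simulation is the converse of the graph of
`compIn`, and injectivity of `compIn` recovers the source vertex in `s i`. -/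
theorem sim_exit_comp (i : Fin p) (s : Fin p → SyncTree Sg q) :
    Sim ((exit Sg i).comp s) (s i) ((exit Sg i).comp s).root (s i).root := by
  refine ⟨fun x w => x = compIn (exit Sg i) s i ⟨(), rfl⟩ w,
    (compIn_root (exit Sg i) s i ⟨(), rfl⟩).symm, ?_⟩
  rintro (⟨_, ⟨⟩⟩ | ⟨j, ⟨⟨⟩, h⟩, f⟩) w hw
  cases h
  exact ⟨f, compIn_injective _ _ _ _ hw, matches_of_eq rfl fun _ => rfl⟩

theorem sim_comp_exit (i : Fin p) (s : Fin p → SyncTree Sg q) :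
    Sim (s i) ((exit Sg i).comp s) (s i).root ((exit Sg i).comp s).root := by
  have := sim_compIn (exit Sg i) s i ⟨(), rfl⟩ (s i).root
  rwa [compIn_root] at this

theorem sim_zero_comp (s : Fin p → SyncTree Sg q) :
    Sim ((zero Sg p).comp s) (zero Sg q) ((zero Sg p).comp s).root (zero Sg q).root := by
  refine Sim.of_map (t' := zero Sg q) (fun _ => ()) ?_ _
  rintro (⟨⟨⟩, _⟩ | ⟨_, ⟨⟨⟩, _⟩, _⟩)

theorem relabel_self : ∀ (l : Label Sg p) (h : l.IsLetter), l.relabel p h = l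
  | .letter _ _, _ => rfl

theorem isLetter_relabel : ∀ (l : Label Sg p) (h : l.IsLetter), (l.relabel q h).IsLetter
  | .letter _ _, _ => trivial

theorem relabel_relabel : ∀ (l : Label Sg p) (h : l.IsLetter) (h' : (l.relabel q h).IsLetter),
    (l.relabel q h).relabel m h' = l.relabel m h
  | .letter _ _, _, _ => rfl

theorem not_isLetter_exit {l : Label Sg p} {i : Fin p} (h : l = .exit i) : ¬ l.IsLetter := by
  subst h; exact id

theorem isLetter_or_exit : ∀ l : Label Sg p, l.IsLetter ∨ ∃ i, l = .exit i
  | .letter _ _ => .inl trivial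
  | .exit i => .inr ⟨i, rfl⟩

theorem exit_tgt_elim {t : SyncTree Sg p} {e : t.E} {i : Fin p} (h : t.label e = .exit i)
    (j : Fin (t.label e).arity) : False := by
  rw [h] at j
  exact Fin.elim0 j

theorem sim_comp_one (t : SyncTree Sg p) :
    Sim (t.comp (exit Sg)) t (t.comp (exit Sg)).root t.root := by
  -- The second summand is empty, because `exit` has no vertex besides its root; the value there is
  -- immaterial.
  let f : CompV t (exit Sg : Fin p → SyncTree Sg p) → t.V := Sum.elim id fun x => t.src x.2.1.1
  refine Sim.of_map (t := t.comp (exit Sg)) f ?_ (.inl t.root)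
  rintro (⟨e, he⟩ | ⟨i, e, ⟨⟩⟩)
  · exact ⟨e, rfl, matches_of_eq (relabel_self _ he) fun _ => rfl⟩
  · refine ⟨e.1, ?_, matches_of_eq e.2.symm fun j => Fin.elim0 j⟩
    change _ = f (compIn t _ i e (exit Sg i).root)
    rw [compIn_root]; rfl

theorem sim_one_comp (t : SyncTree Sg p) :
    Sim t (t.comp (exit Sg)) t.root (t.comp (exit Sg)).root := by
  refine Sim.of_map (t' := t.comp (exit Sg)) Sum.inl ?_ t.root
  intro e
  rcases isLetter_or_exit (t.label e) with he | ⟨i, he⟩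
  · exact ⟨.inl ⟨e, he⟩, rfl, matches_of_eq (relabel_self _ he).symm fun _ => rfl⟩
  · refine ⟨.inr ⟨i, ⟨e, he⟩, ()⟩, ?_, matches_of_eq he fun j => (exit_tgt_elim he j).elim⟩
    exact compIn_root t (exit Sg) i ⟨e, he⟩

/-- Only this direction needs a vertex map. The converse follows from the sum being a join and
composition being monotone in its first argument. -/
theorem sim_add_comp (t t' : SyncTree Sg p) (s : Fin p → SyncTree Sg q) :
    Sim ((t.add t').comp s) ((t.comp s).add (t'.comp s)) ((t.add t').comp s).root
      ((t.comp s).add (t'.comp s)).root := by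
  let f : CompV (t.add t') s → AddV (t.comp s) (t'.comp s) := fun x =>
    match x with
    | .inl none => none
    | .inl (some (.inl v)) => addInl (t.comp s) (t'.comp s) (.inl v.1)
    | .inl (some (.inr v)) => addInr (t.comp s) (t'.comp s) (.inl v.1)
    | .inr ⟨i, ⟨.inl e, h⟩, w⟩ => addInl (t.comp s) (t'.comp s) (.inr ⟨i, ⟨e, h⟩, w⟩)
    | .inr ⟨i, ⟨.inr e, h⟩, w⟩ => addInr (t.comp s) (t'.comp s) (.inr ⟨i, ⟨e, h⟩, w⟩)
  have hl : ∀ v, f (.inl (addInl t t' v)) = addInl (t.comp s) (t'.comp s) (.inl v) := by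
    intro v
    by_cases hv : v = t.root
    · subst hv; rw [addInl_root]; exact (addInl_root (t.comp s) (t'.comp s)).symm
    · rw [addInl_ne _ _ hv]
  have hr : ∀ v, f (.inl (addInr t t' v)) = addInr (t.comp s) (t'.comp s) (.inl v) := by
    intro v
    by_cases hv : v = t'.root
    · subst hv; rw [addInr_root]; exact (addInr_root (t.comp s) (t'.comp s)).symm
    · rw [addInr_ne _ _ hv]
  have hl' : ∀ i e h w, f (compIn (t.add t') s i ⟨.inl e, h⟩ w) =
      addInl (t.comp s) (t'.comp s) (compIn t s i ⟨e, h⟩ w) := by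
    intro i e h w
    by_cases hw : w = (s i).root
    · subst hw; rw [compIn_root, compIn_root]; exact hl _
    · rw [compIn_ne _ _ _ _ hw, compIn_ne _ _ _ _ hw]
  have hr' : ∀ i e h w, f (compIn (t.add t') s i ⟨.inr e, h⟩ w) =
      addInr (t.comp s) (t'.comp s) (compIn t' s i ⟨e, h⟩ w) := by
    intro i e h w
    by_cases hw : w = (s i).root
    · subst hw; rw [compIn_root, compIn_root]; exact hr _
    · rw [compIn_ne _ _ _ _ hw, compIn_ne _ _ _ _ hw]
  refine Sim.of_map (t := (t.add t').comp s) (t' := (t.comp s).add (t'.comp s)) f ?_ (.inl none)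
  rintro (⟨e | e, he⟩ | ⟨i, ⟨e | e, he⟩, g⟩)
  · exact ⟨.inl (.inl ⟨e, he⟩), (hl _).symm, matches_of_eq rfl fun _ => hl _⟩
  · exact ⟨.inr (.inl ⟨e, he⟩), (hr _).symm, matches_of_eq rfl fun _ => hr _⟩
  · exact ⟨.inl (.inr ⟨i, ⟨e, he⟩, g⟩), (hl' _ _ _ _).symm, matches_of_eq rfl fun _ => hl' _ _ _ _⟩
  · exact ⟨.inr (.inr ⟨i, ⟨e, he⟩, g⟩), (hr' _ _ _ _).symm, matches_of_eq rfl fun _ => hr' _ _ _ _⟩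

theorem sim_comp_assoc (t : SyncTree Sg p) (s : Fin p → SyncTree Sg q)
    (r : Fin q → SyncTree Sg m) :
    Sim ((t.comp s).comp r) (t.comp fun i => (s i).comp r) ((t.comp s).comp r).root
      (t.comp fun i => (s i).comp r).root := by
  let f : CompV (t.comp s) r → CompV t (fun i => (s i).comp r) := fun x =>
    match x with
    | .inl (.inl v) => .inl v
    | .inl (.inr ⟨i, e, w⟩) => compIn t (fun i => (s i).comp r) i e (.inl w.1)
    -- Edges of `t.comp s` inherited from `t` carry letters, so an exit edge always comes from a
    -- copy of some `s i`.
    | .inr ⟨_, ⟨.inl e, h⟩, _⟩ => (not_isLetter_exit h (isLetter_relabel _ e.2)).elim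
    | .inr ⟨j, ⟨.inr ⟨i, e, g⟩, h⟩, x⟩ =>
      compIn t (fun i => (s i).comp r) i e (.inr ⟨j, ⟨g, h⟩, x⟩)
  have h1 : ∀ i e w, f (.inl (compIn t s i e w)) =
      compIn t (fun i => (s i).comp r) i e (.inl w) := by
    intro i e w
    by_cases hw : w = (s i).root
    · subst hw; rw [compIn_root]; exact (compIn_root t (fun i => (s i).comp r) i e).symm
    · rw [compIn_ne _ _ _ _ hw]
  have h2 : ∀ j i e g h x, f (compIn (t.comp s) r j ⟨.inr ⟨i, e, g⟩, h⟩ x) =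
      compIn t (fun i => (s i).comp r) i e (compIn (s i) r j ⟨g, h⟩ x) := by
    intro j i e g h x
    by_cases hx : x = (r j).root
    · subst hx; rw [compIn_root, compIn_root]; exact h1 _ _ _
    · rw [compIn_ne _ _ _ _ hx, compIn_ne _ _ _ _ hx]
  refine Sim.of_map (t := (t.comp s).comp r) (t' := t.comp fun i => (s i).comp r) f ?_
    (.inl (.inl t.root))
  rintro (⟨⟨e, he⟩ | ⟨i, e, g⟩, h⟩ | ⟨j, ⟨⟨e, he⟩ | ⟨i, e, g⟩, h⟩, k⟩)
  · exact ⟨.inl ⟨e, he⟩, rfl, matches_of_eq (relabel_relabel _ he _) fun _ => rfl⟩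
  · exact ⟨.inr ⟨i, e, .inl ⟨g, h⟩⟩, (h1 _ _ _).symm, matches_of_eq rfl fun _ => h1 _ _ _⟩
  · exact (not_isLetter_exit h (isLetter_relabel _ he)).elim
  · exact ⟨.inr ⟨i, e, .inr ⟨j, ⟨g, h⟩, k⟩⟩, (h2 _ _ _ _ _ _).symm,
      matches_of_eq rfl fun _ => h2 _ _ _ _ _ _⟩

theorem sim_comp_assoc' (t : SyncTree Sg p) (s : Fin p → SyncTree Sg q)
    (r : Fin q → SyncTree Sg m) :
    Sim (t.comp fun i => (s i).comp r) ((t.comp s).comp r)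
      (t.comp fun i => (s i).comp r).root ((t.comp s).comp r).root := by
  let f : CompV t (fun i => (s i).comp r) → CompV (t.comp s) r := fun x =>
    match x with
    | .inl v => .inl (.inl v)
    -- A non-root vertex of `(s i).comp r` either belongs to `s i` or lies in a copy of some `r j`
    -- attached to it.
    | .inr ⟨i, e, ⟨.inl w, _⟩⟩ => .inl (compIn t s i e w)
    | .inr ⟨i, e, ⟨.inr ⟨j, ⟨g, h⟩, x⟩, _⟩⟩ => .inr ⟨j, ⟨.inr ⟨i, e, g⟩, h⟩, x⟩
  have h1 : ∀ i e w, f (compIn t (fun i => (s i).comp r) i e (.inl w)) =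
      .inl (compIn t s i e w) := by
    intro i e w
    by_cases hw : w = (s i).root
    · subst hw
      rw [compIn_root]
      exact congrArg f (compIn_root t (fun i => (s i).comp r) i e)
    · exact congrArg f (compIn_ne t (fun i => (s i).comp r) i e (v := .inl w)
        fun h => hw (Sum.inl_injective h))
  have h2 : ∀ j i e g h x, f (compIn t (fun i => (s i).comp r) i e (compIn (s i) r j ⟨g, h⟩ x)) =
      compIn (t.comp s) r j ⟨.inr ⟨i, e, g⟩, h⟩ x := by
    intro j i e g h x
    by_cases hx : x = (r j).root
    · subst hx; rw [compIn_root, compIn_root]; exact h1 _ _ _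
    · rw [compIn_ne _ _ _ _ hx, compIn_ne _ _ _ _ hx]
      exact congrArg f (compIn_ne t (fun i => (s i).comp r) i e
        (v := .inr ⟨j, ⟨g, h⟩, ⟨x, hx⟩⟩) Sum.inr_ne_inl)
  refine Sim.of_map (t := t.comp fun i => (s i).comp r) (t' := (t.comp s).comp r) f ?_
    (.inl t.root)
  rintro (⟨e, he⟩ | ⟨i, e, ⟨g, h⟩ | ⟨j, ⟨g, h⟩, k⟩⟩)
  · exact ⟨.inl ⟨.inl ⟨e, he⟩, isLetter_relabel _ he⟩, rfl,
      matches_of_eq (relabel_relabel _ he _).symm fun _ => rfl⟩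
  · exact ⟨.inl ⟨.inr ⟨i, e, g⟩, h⟩, (h1 _ _ _).symm, matches_of_eq rfl fun _ => h1 _ _ _⟩
  · exact ⟨.inr ⟨j, ⟨.inr ⟨i, e, g⟩, h⟩, k⟩, (h2 _ _ _ _ _ _).symm,
      matches_of_eq rfl fun _ => h2 _ _ _ _ _ _⟩

end SyncTree

/-! ### The axioms of ordered idempotent grove theories for `SFST` -/

namespace SFST

variable {Sg : ℕ → Type u} {n p q : ℕ}

theorem mk_eq_mk {t s : FST Sg n p} :
    (Quotient.mk (FST.simEquiv Sg n p) t) = Quotient.mk _ s ↔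
      FST.Simulated t s ∧ FST.Simulated s t := Quotient.eq

/-- Being a join, `t + s` is equivalent to `s` exactly when `s` simulates `t`. -/
theorem le_mk {t s : FST Sg n p} :
    (SFST Sg).le (Quotient.mk (FST.simEquiv Sg n p) t) (Quotient.mk _ s) ↔ FST.Simulated t s := by
  refine mk_eq_mk.trans ⟨fun h i => ?_, fun h => ⟨fun i => ?_, fun i => ?_⟩⟩
  · exact (SyncTree.sim_add_iff.1 (h.1 i)).1
  · exact SyncTree.sim_add_iff.2 ⟨h i, .refl _ _⟩
  · exact SyncTree.sim_add_right _ _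

theorem dist_comp_mk (i : Fin n) (t : FST Sg n p) :
    (SFST Sg).comp ((SFST Sg).dist i) (Quotient.mk (FST.simEquiv Sg n p) t) =
      Quotient.mk (FST.simEquiv Sg 1 p) fun _ => t i :=
  mk_eq_mk.2 ⟨fun _ => SyncTree.sim_exit_comp i fun j => (t j).1,
    fun _ => SyncTree.sim_comp_exit i fun j => (t j).1⟩

theorem isOrderedIdempotentGroveTheory (Sg : ℕ → Type u) :
    (SFST Sg).IsOrderedIdempotentGroveTheory where
  assoc := by
    rintro m n p q ⟨f⟩ ⟨g⟩ ⟨h⟩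
    exact mk_eq_mk.2 ⟨fun i => SyncTree.sim_comp_assoc _ _ _,
      fun i => SyncTree.sim_comp_assoc' _ _ _⟩
  one_comp := by
    rintro n p ⟨f⟩
    exact mk_eq_mk.2 ⟨fun i => SyncTree.sim_exit_comp i fun j => (f j).1,
      fun i => SyncTree.sim_comp_exit i fun j => (f j).1⟩
  comp_one := by
    rintro n p ⟨f⟩
    exact mk_eq_mk.2 ⟨fun i => SyncTree.sim_comp_one _, fun i => SyncTree.sim_one_comp _⟩
  tupling := by
    intro n p f
    choose t ht using fun i => Quotient.exists_rep (f i)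
    refine ⟨Quotient.mk _ fun i => t i 0, fun i => ?_, ?_⟩
    · rw [dist_comp_mk, ← ht]
      congr 1
      funext j
      rw [Subsingleton.elim j 0]
    · rintro ⟨g⟩ hg
      have key : ∀ i, Quotient.mk (FST.simEquiv Sg 1 p) (fun _ => g i) = Quotient.mk _ (t i) := by
        intro i
        rw [ht, ← hg i]
        exact (dist_comp_mk i g).symm
      exact mk_eq_mk.2 ⟨fun i => (mk_eq_mk.1 (key i)).1 0, fun i => (mk_eq_mk.1 (key i)).2 0⟩
  dist_one := by
    refine congrArg (Quotient.mk _) (funext fun i => ?_)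
    rw [Subsingleton.elim i 0]
    rfl
  add_assoc := by
    rintro n p ⟨f⟩ ⟨g⟩ ⟨h⟩
    refine mk_eq_mk.2 ⟨fun i => ?_, fun i => ?_⟩
    · have H := SyncTree.sim_add_iff.1 (SyncTree.Sim.refl ((f i).1.add ((g i).1.add (h i).1)) _)
      have H' := SyncTree.sim_add_iff.1 H.2
      exact SyncTree.sim_add (SyncTree.sim_add H.1 H'.1) H'.2
    · have H := SyncTree.sim_add_iff.1 (SyncTree.Sim.refl (((f i).1.add (g i).1).add (h i).1) _)
      have H' := SyncTree.sim_add_iff.1 H.1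
      exact SyncTree.sim_add H'.1 (SyncTree.sim_add H'.2 H.2)
  add_comm := by
    rintro n p ⟨f⟩ ⟨g⟩
    exact mk_eq_mk.2
      ⟨fun i => SyncTree.sim_add (SyncTree.sim_add_right _ _) (SyncTree.sim_add_left _ _),
        fun i => SyncTree.sim_add (SyncTree.sim_add_right _ _) (SyncTree.sim_add_left _ _)⟩
  zero_add := by
    rintro n p ⟨f⟩
    exact mk_eq_mk.2 ⟨fun i => SyncTree.sim_add (SyncTree.sim_zero _ _) (.refl _ _),
      fun i => SyncTree.sim_add_right _ _⟩
  dist_comp_add := by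
    rintro n p i ⟨f⟩ ⟨g⟩
    exact (dist_comp_mk i _).trans
      (congrArg₂ (SFST Sg).add (dist_comp_mk i f) (dist_comp_mk i g)).symm
  dist_comp_zero := fun _ i => dist_comp_mk i _
  add_comp := by
    rintro n p q ⟨f⟩ ⟨g⟩ ⟨h⟩
    refine mk_eq_mk.2 ⟨fun i => SyncTree.sim_add_comp _ _ _, fun i => SyncTree.sim_add ?_ ?_⟩
    · exact SyncTree.Simulated.comp (SyncTree.sim_add_left _ _) fun _ => .refl _
    · exact SyncTree.Simulated.comp (SyncTree.sim_add_right _ _) fun _ => .refl _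
  zero_comp := by
    rintro n p q ⟨h⟩
    exact mk_eq_mk.2 ⟨fun i => SyncTree.sim_zero_comp _, fun i => SyncTree.sim_zero _ _⟩
  add_idem := by
    rintro n p ⟨f⟩
    exact le_mk.2 fun i => .refl _
  comp_mono := by
    rintro n p q ⟨f⟩ ⟨g⟩ ⟨h⟩ H
    exact le_mk.2 fun i => SyncTree.Simulated.comp (.refl _) (le_mk.1 H)

end SFST

/-! ### Tuples and finite joins -/

namespace GroveData

variable {T : GroveData.{w}} {n p q : ℕ}

/-- The tuple of a family of morphisms `1 → p`. -/
noncomputable def tuple (hT : T.IsTheory) (f : Fin n → T.Hom 1 p) : T.Hom n p :=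
  (hT.tupling f).choose

theorem dist_comp_tuple (hT : T.IsTheory) (f : Fin n → T.Hom 1 p) (i : Fin n) :
    T.comp (T.dist i) (tuple hT f) = f i :=
  (hT.tupling f).choose_spec.1 i

theorem IsTheory.hom_ext (hT : T.IsTheory) {f g : T.Hom n p}
    (h : ∀ i, T.comp (T.dist i) f = T.comp (T.dist i) g) : f = g :=
  (hT.tupling fun i => T.comp (T.dist i) g).unique h fun _ => rfl

theorem tuple_comp (hT : T.IsTheory) (f : Fin n → T.Hom 1 p) (g : T.Hom p q) :
    T.comp (tuple hT f) g = tuple hT fun i => T.comp (f i) g :=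
  hT.hom_ext fun i => by rw [← hT.assoc, dist_comp_tuple, dist_comp_tuple]

theorem tuple_dist (hT : T.IsTheory) : tuple hT (fun i : Fin n => T.dist i) = T.one n :=
  hT.hom_ext fun i => by rw [dist_comp_tuple, hT.comp_one]

theorem Morphism.map_tuple {S : GroveData.{u}} (F : Morphism S T) (hS : S.IsTheory)
    (hT : T.IsTheory) (f : Fin n → S.Hom 1 p) :
    F.map (tuple hS f) = tuple hT fun i => F.map (f i) :=
  hT.hom_ext fun i => by rw [dist_comp_tuple, ← F.map_dist, ← F.map_comp, dist_comp_tuple]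

theorem Morphism.ext {S : GroveData.{u}} {F G : Morphism S T}
    (h : ∀ {n p : ℕ} (f : S.Hom n p), F.map f = G.map f) : F = G := by
  cases F; cases G
  congr
  funext n p f
  exact h f


/-! ### The semilattice order of an idempotent grove theory -/

namespace IsIdempotentGroveTheory

theorem le_refl (hT : T.IsIdempotentGroveTheory) (f : T.Hom n p) : T.le f f := hT.add_idem f

theorem le_trans (hT : T.IsIdempotentGroveTheory) {f g h : T.Hom n p} (hf : T.le f g)
    (hg : T.le g h) : T.le f h := by
  change T.add f h = h
  rw [← show T.add g h = h from hg, ← hT.add_assoc, show T.add f g = g from hf]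

theorem le_antisymm (hT : T.IsIdempotentGroveTheory) {f g : T.Hom n p} (hf : T.le f g)
    (hg : T.le g f) : f = g := by
  rw [← show T.add g f = f from hg, hT.add_comm]
  exact hf

theorem add_le_iff (hT : T.IsIdempotentGroveTheory) {f g h : T.Hom n p} :
    T.le (T.add f g) h ↔ T.le f h ∧ T.le g h := by
  constructor
  · intro H
    constructor
    · refine hT.le_trans (g := T.add f g) ?_ H
      change T.add f (T.add f g) = _
      rw [← hT.add_assoc, hT.add_idem]
    · refine hT.le_trans (g := T.add f g) ?_ H
      change T.add g (T.add f g) = _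
      rw [hT.add_comm f, ← hT.add_assoc, hT.add_idem]
  · rintro ⟨hf, hg⟩
    change T.add (T.add f g) h = h
    rw [hT.add_assoc, show T.add g h = h from hg]
    exact hf

/-- Elements of a poset with the same upper bounds agree. Together with `join_le_iff` this replaces
computations with sums by quantification over edges. -/
theorem eq_of_forall_le_iff (hT : T.IsIdempotentGroveTheory) {f g : T.Hom n p}
    (h : ∀ y, T.le f y ↔ T.le g y) : f = g :=
  hT.le_antisymm ((h g).2 (hT.le_refl g)) ((h f).1 (hT.le_refl f))

theorem le_of_dist (hT : T.IsIdempotentGroveTheory) {f g : T.Hom n p}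
    (h : ∀ i, T.le (T.comp (T.dist i) f) (T.comp (T.dist i) g)) : T.le f g :=
  hT.hom_ext fun i => by rw [hT.dist_comp_add]; exact h i

end IsIdempotentGroveTheory

/-- The sum of a finite family of morphisms. -/
noncomputable def join {ι : Type} [Finite ι] (f : ι → T.Hom n p) : T.Hom n p :=
  (((@Finset.univ ι (Fintype.ofFinite ι)).toList).map f).foldr T.add (T.zero n p)

theorem foldr_le_iff (hT : T.IsIdempotentGroveTheory) {y : T.Hom n p} :
    ∀ l : List (T.Hom n p), T.le (l.foldr T.add (T.zero n p)) y ↔ ∀ x ∈ l, T.le x y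
  | [] => iff_of_true (hT.zero_add y) (by simp)
  | a :: l => by simp [hT.add_le_iff, foldr_le_iff hT l]

theorem join_le_iff (hT : T.IsIdempotentGroveTheory) {ι : Type} [Finite ι] (f : ι → T.Hom n p)
    {y : T.Hom n p} : T.le (join f) y ↔ ∀ i, T.le (f i) y := by
  simp [join, foldr_le_iff hT]

theorem le_join (hT : T.IsIdempotentGroveTheory) {ι : Type} [Finite ι] (f : ι → T.Hom n p)
    (i : ι) : T.le (f i) (join f) :=
  (join_le_iff hT f).1 (hT.le_refl _) i

theorem join_comp (hT : T.IsGroveTheory) {ι : Type} [Finite ι] (f : ι → T.Hom n p)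
    (h : T.Hom p q) : T.comp (join f) h = join fun i => T.comp (f i) h := by
  have key : ∀ l : List ι, T.comp ((l.map f).foldr T.add (T.zero n p)) h =
      (l.map fun i => T.comp (f i) h).foldr T.add (T.zero n q) := by
    intro l
    induction l with
    | nil => exact hT.zero_comp n h
    | cons a l ih => simp [hT.add_comp, ih]
  exact key _

theorem Morphism.map_join {S : GroveData.{u}} (F : Morphism S T) {ι : Type} [Finite ι]
    (f : ι → S.Hom n p) : F.map (join f) = join fun i => F.map (f i) := by
  have key : ∀ l : List ι, F.map ((l.map f).foldr S.add (S.zero n p)) =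
      (l.map fun i => F.map (f i)).foldr T.add (T.zero n p) := by
    intro l
    induction l with
    | nil => exact F.map_zero n p
    | cons a l ih => simp [F.map_add, ih]
  exact key _

end GroveData

open GroveData

/-! ### Evaluation of finite trees -/

namespace SyncTree

variable {Sg : ℕ → Type u} {p q : ℕ}

instance (t : {t : SyncTree Sg p // t.IsFinite}) : Finite t.1.E := t.2

instance (t t' : SyncTree Sg p) [Finite t.E] [Finite t'.E] : Finite (t.add t').E :=
  IsFinite.add (t := t) (t' := t') ‹_› ‹_›

instance (t : SyncTree Sg p) (s : Fin p → SyncTree Sg q) [Finite t.E] [∀ i, Finite (s i).E] :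
    Finite (t.comp s).E :=
  IsFinite.comp (t := t) (s := s) ‹_› ‹_›

instance : Finite (zero Sg p).E := isFinite_zero

instance (i : Fin p) : Finite (exit Sg i).E := isFinite_exit i

instance {k : ℕ} (σ : Sg k) : Finite (letter σ).E := isFinite_letter σ

/-- `w` is a target of an edge with source `v`. -/
def IsChild (t : SyncTree Sg p) (w v : t.V) : Prop :=
  ∃ (e : t.E) (i : Fin (t.label e).arity), t.src e = v ∧ t.tgt e i = w

/-- The length of the path from the root. -/
noncomputable def depth (t : SyncTree Sg p) (v : t.V) : ℕ := (t.isTree v).choose.length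

theorem depth_tgt (t : SyncTree Sg p) (e : t.E) (i : Fin (t.label e).arity) :
    t.depth (t.tgt e i) = t.depth (t.src e) + 1 := by
  have h := (t.isTree (t.src e)).choose_spec.1
  have h' := (t.isTree (t.tgt e i)).choose_spec.2 _
    ((t.toHyperGraph.isPath_append_singleton ⟨e, i⟩ _ _ _).2 ⟨h, rfl⟩)
  unfold depth
  rw [← h', List.length_append]
  rfl

/-- Every vertex is the root or a target of one of finitely many edges, each of finite arity. -/
theorem finite_vertices (t : SyncTree Sg p) [Finite t.E] : Finite t.V := by
  refine Finite.of_surjective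
    (fun x : Option t.Step => x.elim t.root fun s => t.tgt s.1 s.2) fun v => ?_
  exact t.vertex_induction (P := fun v => ∃ x : Option t.Step,
    (x.elim t.root fun s => t.tgt s.1 s.2) = v) ⟨none, rfl⟩ (fun e i _ => ⟨some ⟨e, i⟩, rfl⟩) v

/-- Depth increases by one along each edge and is bounded on the finite vertex set, so the distance
to a bound `B` strictly decreases. This justifies recursion from the leaves towards the root. -/
theorem isChild_wellFounded (t : SyncTree Sg p) [Finite t.E] : WellFounded t.IsChild := by
  have := t.finite_vertices
  obtain ⟨B, hB⟩ := (Set.finite_range t.depth).bddAbove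
  refine Subrelation.wf (r := InvImage (· < ·) fun v => B - t.depth v) ?_
    (InvImage.wf _ wellFounded_lt)
  rintro _ _ ⟨e, i, rfl, rfl⟩
  have h1 := hB (Set.mem_range_self (t.tgt e i))
  have h2 := t.depth_tgt e i
  change B - _ < B - _
  omega

end SyncTree

/-! ### Values of finite trees in a theory -/

section Eval

variable {Sg : ℕ → Type u} {T : GroveData.{w}} {p q : ℕ}

/-- The value of an edge with label `l` whose targets have the values `x`. -/
noncomputable def labelVal (hT : T.IsTheory) (φ : (k : ℕ) → Sg k → T.Hom 1 k) :
    (l : Label Sg p) → (Fin l.arity → T.Hom 1 p) → T.Hom 1 p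
  | .letter k σ, x => T.comp (φ k σ) (tuple hT (n := k) x)
  | .exit i, _ => T.dist i

/-- The value at the vertex `v` of a finite tree. -/
noncomputable def eval (hT : T.IsTheory) (φ : (k : ℕ) → Sg k → T.Hom 1 k) (t : SyncTree Sg p)
    [Finite t.E] : t.V → T.Hom 1 p :=
  t.isChild_wellFounded.fix fun v ih =>
    join fun e : {e : t.E // t.src e = v} =>
      labelVal hT φ (t.label e.1) fun i => ih (t.tgt e.1 i) ⟨e.1, i, e.2, rfl⟩

theorem eval_eq (hT : T.IsTheory) (φ : (k : ℕ) → Sg k → T.Hom 1 k) (t : SyncTree Sg p)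
    [Finite t.E] (v : t.V) : eval hT φ t v = join fun e : {e : t.E // t.src e = v} =>
      labelVal hT φ (t.label e.1) fun i => eval hT φ t (t.tgt e.1 i) :=
  WellFounded.fix_eq _ _ _

/-- This is where the axiom `comp_mono` of the target theory enters; the tuples of target values are
compared componentwise. -/
theorem labelVal_mono (hT : T.IsOrderedIdempotentGroveTheory) (φ : (k : ℕ) → Sg k → T.Hom 1 k)
    {l l' : Label Sg p} (h : l' = l) {x : Fin l.arity → T.Hom 1 p} {x' : Fin l'.arity → T.Hom 1 p}
    (hx : ∀ (i : Fin l.arity) (i' : Fin l'.arity), (i : ℕ) = i' → T.le (x i) (x' i')) :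
    T.le (labelVal hT.toIsTheory φ l x) (labelVal hT.toIsTheory φ l' x') := by
  subst h
  cases l' with
  | letter k σ =>
    refine hT.comp_mono _ _ _ (hT.le_of_dist fun i => ?_)
    have h := hx i i rfl
    rwa [← dist_comp_tuple hT.toIsTheory (n := k) x,
      ← dist_comp_tuple hT.toIsTheory (n := k) x'] at h
  | exit i => exact hT.le_refl _

theorem labelVal_congr (hT : T.IsTheory) (φ : (k : ℕ) → Sg k → T.Hom 1 k)
    {l l' : Label Sg p} (h : l' = l) {x : Fin l.arity → T.Hom 1 p} {x' : Fin l'.arity → T.Hom 1 p}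
    (hx : ∀ (i : Fin l.arity) (i' : Fin l'.arity), (i : ℕ) = i' → x i = x' i') :
    labelVal hT φ l x = labelVal hT φ l' x' := by
  subst h
  rw [show x = x' from funext fun i => hx i i rfl]

/-- The upper bounds of a value are those of the contributions of its edges. Later computations of
values mostly go through this description instead of the join. -/
theorem eval_le_iff (hT : T.IsIdempotentGroveTheory) (φ : (k : ℕ) → Sg k → T.Hom 1 k)
    (t : SyncTree Sg p) [Finite t.E] {v : t.V} {y : T.Hom 1 p} :
    T.le (eval hT.toIsTheory φ t v) y ↔ ∀ e, t.src e = v →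
      T.le (labelVal hT.toIsTheory φ (t.label e) fun i => eval hT.toIsTheory φ t (t.tgt e i)) y := by
  rw [eval_eq, join_le_iff hT, Subtype.forall]

theorem le_eval (hT : T.IsIdempotentGroveTheory) (φ : (k : ℕ) → Sg k → T.Hom 1 k)
    (t : SyncTree Sg p) [Finite t.E] (e : t.E) :
    T.le (labelVal hT.toIsTheory φ (t.label e) fun i => eval hT.toIsTheory φ t (t.tgt e i))
      (eval hT.toIsTheory φ t (t.src e)) :=
  (eval_le_iff hT φ t).1 (hT.le_refl _) e rfl

/-- By induction over the vertices of `t`, each edge at `v` contributes at most what its matching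
edge at `v'` does. This makes the value well defined on simulation equivalence classes. -/
theorem eval_le_eval (hT : T.IsOrderedIdempotentGroveTheory) (φ : (k : ℕ) → Sg k → T.Hom 1 k)
    {t t' : SyncTree Sg p} [Finite t.E] [Finite t'.E] {v : t.V} {v' : t'.V}
    (h : SyncTree.Sim t t' v v') :
    T.le (eval hT.toIsTheory φ t v) (eval hT.toIsTheory φ t' v') := by
  induction v using t.isChild_wellFounded.induction generalizing v' with
  | _ v ih =>
    rw [eval_le_iff hT.toIsIdempotentGroveTheory]
    rintro e rfl
    obtain ⟨e', rfl, hl, H⟩ := h.exists_matches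
    exact hT.le_trans (labelVal_mono hT φ hl fun i i' hi => ih _ ⟨e, i, rfl, rfl⟩ (H i i' hi))
      (le_eval hT.toIsIdempotentGroveTheory φ t' e')

/-- The values of a finite tree are determined by their recursive description. -/
theorem eq_eval (hT : T.IsIdempotentGroveTheory) (φ : (k : ℕ) → Sg k → T.Hom 1 k)
    (t : SyncTree Sg p) [Finite t.E] {g : t.V → T.Hom 1 p}
    (hg : ∀ v y, T.le (g v) y ↔ ∀ e, t.src e = v →
      T.le (labelVal hT.toIsTheory φ (t.label e) fun i => g (t.tgt e i)) y) (v : t.V) :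
    g v = eval hT.toIsTheory φ t v := by
  induction v using t.isChild_wellFounded.induction with
  | _ v ih =>
    refine hT.eq_of_forall_le_iff fun y => ?_
    rw [hg, eval_le_iff hT]
    refine forall_congr' fun e => forall_congr' fun he => ?_
    rw [labelVal_congr hT.toIsTheory φ rfl fun i i' hi => ?_]
    rw [Fin.ext hi]
    exact ih _ ⟨e, i', he, rfl⟩

theorem eval_add (hT : T.IsOrderedIdempotentGroveTheory) (φ : (k : ℕ) → Sg k → T.Hom 1 k)
    (t t' : SyncTree Sg p) [Finite t.E] [Finite t'.E] :
    eval hT.toIsTheory φ (t.add t') (t.add t').root =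
      T.add (eval hT.toIsTheory φ t t.root) (eval hT.toIsTheory φ t' t'.root) := by
  -- The guessed values: the sum at the merged root, and the old values elsewhere. It remains to
  -- verify the recursive description required by `eq_eval`.
  let g : t.AddV t' → T.Hom 1 p := fun x =>
    match x with
    | none => T.add (eval hT.toIsTheory φ t t.root) (eval hT.toIsTheory φ t' t'.root)
    | some (.inl v) => eval hT.toIsTheory φ t v.1
    | some (.inr v) => eval hT.toIsTheory φ t' v.1
  have hl : ∀ e i, g (t.addInl t' (t.tgt e i)) = eval hT.toIsTheory φ t (t.tgt e i) := by
    intro e i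
    rw [SyncTree.addInl_ne _ _ (t.tgt_ne_root e i)]
  have hr : ∀ e i, g (t.addInr t' (t'.tgt e i)) = eval hT.toIsTheory φ t' (t'.tgt e i) := by
    intro e i
    rw [SyncTree.addInr_ne _ _ (t'.tgt_ne_root e i)]
  have hl' : ∀ e : t.E, labelVal hT.toIsTheory φ ((t.add t').label (.inl e))
      (fun i => g ((t.add t').tgt (.inl e) i)) =
      labelVal hT.toIsTheory φ (t.label e) fun i => eval hT.toIsTheory φ t (t.tgt e i) :=
    fun e => congrArg (labelVal hT.toIsTheory φ (t.label e)) (funext fun i => hl e i)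
  have hr' : ∀ e : t'.E, labelVal hT.toIsTheory φ ((t.add t').label (.inr e))
      (fun i => g ((t.add t').tgt (.inr e) i)) =
      labelVal hT.toIsTheory φ (t'.label e) fun i => eval hT.toIsTheory φ t' (t'.tgt e i) :=
    fun e => congrArg (labelVal hT.toIsTheory φ (t'.label e)) (funext fun i => hr e i)
  refine (eq_eval hT.toIsIdempotentGroveTheory φ (t.add t') (g := g) ?_ none).symm
  have hsl : ∀ (e : t.E) x, (t.add t').src (.inl e) = x ↔ t.addInl t' (t.src e) = x :=
    fun _ _ => Iff.rfl
  have hsr : ∀ (e : t'.E) x, (t.add t').src (.inr e) = x ↔ t.addInr t' (t'.src e) = x :=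
    fun _ _ => Iff.rfl
  have hln : ∀ a, t.addInl t' a = none ↔ a = t.root := fun a => by
    by_cases h : a = t.root <;> simp [SyncTree.addInl, SyncTree.glue, h]
  have hrn : ∀ a, t.addInr t' a = none ↔ a = t'.root := fun a => by
    by_cases h : a = t'.root <;> simp [SyncTree.addInr, SyncTree.glue, h]
  have hlv : ∀ a v, t.addInl t' a = some (.inl v) ↔ a = v.1 := fun a v => by
    by_cases h : a = t.root
    · simp [SyncTree.addInl, SyncTree.glue, h, v.2.symm]
    · simp [SyncTree.addInl, SyncTree.glue, h, Subtype.ext_iff]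
  have hrv : ∀ a v, t.addInr t' a = some (.inr v) ↔ a = v.1 := fun a v => by
    by_cases h : a = t'.root
    · simp [SyncTree.addInr, SyncTree.glue, h, v.2.symm]
    · simp [SyncTree.addInr, SyncTree.glue, h, Subtype.ext_iff]
  have hlw : ∀ a v, ¬ t.addInl t' a = some (.inr v) := fun a v => by
    by_cases h : a = t.root <;> simp [SyncTree.addInl, SyncTree.glue, h]
  have hrw : ∀ a v, ¬ t.addInr t' a = some (.inl v) := fun a v => by
    by_cases h : a = t'.root <;> simp [SyncTree.addInr, SyncTree.glue, h]
  intro v y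
  have split : ∀ P : t.E ⊕ t'.E → Prop, (∀ e, P e) ↔ (∀ e, P (.inl e)) ∧ ∀ e, P (.inr e) :=
    fun _ => Sum.forall
  refine Iff.trans ?_ (split _).symm
  simp only [hl', hr', hsl, hsr]
  rcases v with _ | (v | v)
  · simp only [hln, hrn, ← eval_le_iff hT.toIsIdempotentGroveTheory]
    exact hT.add_le_iff
  · simp only [hlv, hrw, ← eval_le_iff hT.toIsIdempotentGroveTheory]
    simp [g]
  · simp only [hrv, hlw, ← eval_le_iff hT.toIsIdempotentGroveTheory]
    simp [g]

theorem labelVal_comp (hT : T.IsTheory) (φ : (k : ℕ) → Sg k → T.Hom 1 k) (S : T.Hom p q) :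
    ∀ (l : Label Sg p) (h : l.IsLetter) (x : Fin l.arity → T.Hom 1 p),
      T.comp (labelVal hT φ l x) S = labelVal hT φ (l.relabel q h) fun i =>
        T.comp (x (Fin.cast (l.arity_relabel h) i)) S
  | .letter k σ, _, x => by
    exact (hT.assoc _ _ _).trans (congrArg _ (tuple_comp hT (n := k) x S))

theorem eval_comp (hT : T.IsOrderedIdempotentGroveTheory) (φ : (k : ℕ) → Sg k → T.Hom 1 k)
    (t : SyncTree Sg p) (s : Fin p → SyncTree Sg q) [Finite t.E] [∀ i, Finite (s i).E] :
    eval hT.toIsTheory φ (t.comp s) (t.comp s).root =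
      T.comp (eval hT.toIsTheory φ t t.root)
        (tuple hT.toIsTheory fun i => eval hT.toIsTheory φ (s i) (s i).root) := by
  set S := tuple hT.toIsTheory fun i => eval hT.toIsTheory φ (s i) (s i).root with hS
  -- The guessed values: at vertices of `t` the old value is composed with `S`, while a vertex in a
  -- copy of `s i` keeps its value in `s i`, whichever exit edge the copy replaces.
  let g : t.CompV s → T.Hom 1 q := fun x =>
    match x with
    | .inl v => T.comp (eval hT.toIsTheory φ t v) S
    | .inr ⟨i, _, w⟩ => eval hT.toIsTheory φ (s i) w.1
  have hl : ∀ e : {e : t.E // (t.label e).IsLetter}, labelVal hT.toIsTheory φ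
      ((t.comp s).label (.inl e)) (fun i => g ((t.comp s).tgt (.inl e) i)) =
      T.comp (labelVal hT.toIsTheory φ (t.label e.1)
        fun i => eval hT.toIsTheory φ t (t.tgt e.1 i)) S :=
    fun e => (labelVal_comp hT.toIsTheory φ S (t.label e.1) e.2
      fun i => eval hT.toIsTheory φ t (t.tgt e.1 i)).symm
  have hr : ∀ i (e : t.ExitEdge i) (f : (s i).E), labelVal hT.toIsTheory φ
      ((t.comp s).label (.inr ⟨i, e, f⟩)) (fun j => g ((t.comp s).tgt (.inr ⟨i, e, f⟩) j)) =
      labelVal hT.toIsTheory φ ((s i).label f)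
        fun j => eval hT.toIsTheory φ (s i) ((s i).tgt f j) := by
    intro i e f
    refine congrArg (labelVal hT.toIsTheory φ ((s i).label f)) (funext fun j => ?_)
    change g (t.compIn s i e ((s i).tgt f j)) = _
    rw [SyncTree.compIn_ne _ _ _ _ ((s i).tgt_ne_root f j)]
  refine (eq_eval hT.toIsIdempotentGroveTheory φ (t.comp s) (g := g) ?_ (.inl t.root)).symm
  rintro (v | ⟨i, e, w⟩) y
  · have hv : g (.inl v) = T.comp (eval hT.toIsTheory φ t v) S := rfl
    rw [hv, eval_eq, join_comp hT.toIsGroveTheory, join_le_iff hT.toIsIdempotentGroveTheory]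
    -- An exit edge contributes `T.dist i`, and composing with `S` turns this into the root value of
    -- `s i`, that is, the join over the root edges of the copy inserted there.
    have hx : ∀ i (x : _), T.le (T.comp (labelVal hT.toIsTheory φ (.exit i : Label Sg p) x) S) y ↔
        T.le (eval hT.toIsTheory φ (s i) (s i).root) y := by
      intro i x
      simp only [labelVal]
      rw [hS, dist_comp_tuple]
    constructor
    · rintro H (e | ⟨i, e, f⟩) he
      · rw [hl]
        exact H ⟨e.1, Sum.inl_injective he⟩
      · rw [hr]
        change t.compIn s i e ((s i).src f) = .inl v at he
        by_cases hf : (s i).src f = (s i).root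
        · rw [hf, SyncTree.compIn_root] at he
          have H' := H ⟨e.1, Sum.inl_injective he⟩
          -- An exit label has arity `0`, so its family of target values may be replaced by the
          -- empty one.
          rw [labelVal_congr hT.toIsTheory φ e.2.symm
            (x' := fun j => Fin.elim0 j) fun j j' _ => Fin.elim0 j', hx] at H'
          exact (eval_le_iff hT.toIsIdempotentGroveTheory φ (s i)).1 H' f hf
        · rw [SyncTree.compIn_ne _ _ _ _ hf] at he
          cases he
    · rintro H ⟨e, rfl⟩
      rcases SyncTree.isLetter_or_exit (t.label e) with he | ⟨i, he⟩
      · rw [← hl ⟨e, he⟩]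
        exact H (.inl ⟨e, he⟩) rfl
      · rw [labelVal_congr hT.toIsTheory φ he.symm
          (x' := fun j => Fin.elim0 j) fun j j' _ => Fin.elim0 j', hx,
          eval_le_iff hT.toIsIdempotentGroveTheory]
        intro f hf
        rw [← hr i ⟨e, he⟩]
        refine H (.inr ⟨i, ⟨e, he⟩, f⟩) ?_
        change t.compIn s i ⟨e, he⟩ ((s i).src f) = _
        rw [hf, SyncTree.compIn_root]
  -- At a non-root vertex of a copy of `s i`, exactly the edges of that same copy leave.
  · refine (eval_le_iff hT.toIsIdempotentGroveTheory φ (s i)).trans ⟨?_, ?_⟩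
    · rintro H (e' | ⟨j, e', f⟩) he
      · cases he
      · rw [hr]
        change t.compIn s j e' ((s j).src f) = _ at he
        by_cases hf : (s j).src f = (s j).root
        · rw [hf, SyncTree.compIn_root] at he
          cases he
        · rw [SyncTree.compIn_ne _ _ _ _ hf] at he
          cases he
          exact H f rfl
    · intro H f hf
      rw [← hr i e]
      refine H (.inr ⟨i, e, f⟩) ?_
      change t.compIn s i e ((s i).src f) = _
      rw [hf, SyncTree.compIn_ne _ _ _ _ w.2]

theorem eval_exit (hT : T.IsIdempotentGroveTheory) (φ : (k : ℕ) → Sg k → T.Hom 1 k) (i : Fin p) :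
    eval hT.toIsTheory φ (SyncTree.exit Sg i) (SyncTree.exit Sg i).root = T.dist i :=
  hT.eq_of_forall_le_iff fun _ => (eval_le_iff hT φ _).trans
    ⟨fun h => h () rfl, fun h _ _ => h⟩

theorem eval_zero (hT : T.IsIdempotentGroveTheory) (φ : (k : ℕ) → Sg k → T.Hom 1 k) :
    eval hT.toIsTheory φ (SyncTree.zero Sg p) (SyncTree.zero Sg p).root = T.zero 1 p :=
  hT.eq_of_forall_le_iff fun y => (eval_le_iff hT φ _).trans
    ⟨fun _ => hT.zero_add y, fun _ e => Empty.elim e⟩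

theorem eval_letter (hT : T.IsIdempotentGroveTheory) (φ : (k : ℕ) → Sg k → T.Hom 1 k) {k : ℕ}
    (σ : Sg k) :
    eval hT.toIsTheory φ (SyncTree.letter σ) (SyncTree.letter σ).root = φ k σ := by
  have h1 : ∀ i, eval hT.toIsTheory φ (SyncTree.letter σ) (some i) = T.dist i := fun i =>
    hT.eq_of_forall_le_iff fun _ => (eval_le_iff hT φ _).trans
      ⟨fun h => h (some i) rfl, fun h e he => by cases (show e = some i from he); exact h⟩
  have h2 : labelVal hT.toIsTheory φ ((SyncTree.letter σ).label none)
      (fun i => eval hT.toIsTheory φ (SyncTree.letter σ) ((SyncTree.letter σ).tgt none i)) =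
      φ k σ := by
    change T.comp (φ k σ) (tuple hT.toIsTheory fun i : Fin k =>
      eval hT.toIsTheory φ (SyncTree.letter σ) (some i)) = _
    simp only [h1]
    rw [tuple_dist, hT.comp_one]
  refine hT.eq_of_forall_le_iff fun y => (eval_le_iff hT φ _).trans ⟨fun h => ?_, ?_⟩
  · rw [← h2]
    exact h none rfl
  · intro h e he
    cases (show e = none from he)
    rw [h2]
    exact h

end Eval

/-! ### The free extension -/

namespace SFST

variable {Sg : ℕ → Type u} {T : GroveData.{w}} {n p q : ℕ}

/-- The value of a tuple of finite trees. -/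
noncomputable def evalTuple (hT : T.IsTheory) (φ : (k : ℕ) → Sg k → T.Hom 1 k) (t : FST Sg n p) :
    T.Hom n p :=
  tuple hT fun i => eval hT φ (t i).1 (t i).1.root

theorem dist_comp_evalTuple (hT : T.IsTheory) (φ : (k : ℕ) → Sg k → T.Hom 1 k) (t : FST Sg n p)
    (i : Fin n) : T.comp (T.dist i) (evalTuple hT φ t) = eval hT φ (t i).1 (t i).1.root :=
  dist_comp_tuple _ _ _

/-- The morphism from `SFST` that extends `φ`. -/
noncomputable def lift (hT : T.IsOrderedIdempotentGroveTheory)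
    (φ : (k : ℕ) → Sg k → T.Hom 1 k) : Morphism (SFST Sg) T where
  -- Simulations in both directions give inequalities in both directions, hence equal values.
  map := Quotient.lift (evalTuple hT.toIsTheory φ) fun t t' h =>
    congrArg (tuple hT.toIsTheory) (funext fun i =>
      hT.le_antisymm (eval_le_eval hT φ (h.1 i)) (eval_le_eval hT φ (h.2 i)))
  map_comp := by
    rintro n p q ⟨f⟩ ⟨g⟩
    refine Eq.trans ?_ (tuple_comp hT.toIsTheory _ _).symm
    exact congrArg (tuple hT.toIsTheory) (funext fun i => eval_comp hT φ _ _)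
  map_one n := (congrArg (tuple hT.toIsTheory) (funext fun i =>
    eval_exit hT.toIsIdempotentGroveTheory φ i)).trans (tuple_dist _)
  map_dist i := hT.hom_ext fun j => by
    refine (dist_comp_tuple _ _ _).trans ?_
    rw [Subsingleton.elim j 0, hT.dist_one, hT.one_comp]
    exact eval_exit hT.toIsIdempotentGroveTheory φ i
  map_add := by
    rintro n p ⟨f⟩ ⟨g⟩
    refine hT.hom_ext fun i => ?_
    rw [hT.dist_comp_add]
    refine (dist_comp_evalTuple _ φ _ i).trans ((eval_add hT φ _ _).trans ?_)
    exact congrArg₂ T.add (dist_comp_evalTuple hT.toIsTheory φ f i).symm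
      (dist_comp_evalTuple hT.toIsTheory φ g i).symm
  map_zero n p := hT.hom_ext fun i => by
    rw [hT.dist_comp_zero]
    exact (dist_comp_tuple _ _ _).trans (eval_zero hT.toIsIdempotentGroveTheory φ)

theorem lift_letter (hT : T.IsOrderedIdempotentGroveTheory) (φ : (k : ℕ) → Sg k → T.Hom 1 k)
    {k : ℕ} (σ : Sg k) : (lift hT φ).map (SFST.letter σ) = φ k σ :=
  hT.hom_ext fun j => by
    refine (dist_comp_evalTuple hT.toIsTheory φ (FST.letter σ) j).trans ?_
    rw [Subsingleton.elim j 0, hT.dist_one, hT.one_comp]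
    exact eval_letter hT.toIsIdempotentGroveTheory φ σ

end SFST

/-! ### Finite trees are generated by the letters -/

namespace SyncTree

variable {Sg : ℕ → Type u} {p q : ℕ}

/-- If the exit edge is the only edge at its source, nothing but the copy of `s i` grows there. With
further edges at that vertex the composite could do more than `s i`. -/
theorem sim_inl_of_unique {t : SyncTree Sg p} (s : Fin p → SyncTree Sg q) {i : Fin p}
    (e : t.ExitEdge i) (he : ∀ e', t.src e' = t.src e.1 → e' = e.1) :
    Sim (t.comp s) (s i) (.inl (t.src e.1)) (s i).root := by
  refine ⟨fun x w => x = compIn t s i e w, (compIn_root _ _ _ _).symm, ?_⟩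
  rintro (⟨e', he'⟩ | ⟨j, e', f⟩) w hw
  · change Sum.inl (t.src e') = _ at hw
    by_cases h : w = (s i).root
    · subst h
      rw [compIn_root] at hw
      exact (not_isLetter_exit e.2 (he _ (Sum.inl_injective hw) ▸ he')).elim
    · rw [compIn_ne _ _ _ _ h] at hw
      cases hw
  · change compIn t s j e' ((s j).src f) = _ at hw
    -- The edge `f` starts in the copy of `s i` at `e`. Distinct copies can share only a root
    -- vertex, and uniqueness of `e` excludes a second copy rooted there.
    have key : j = i ∧ HEq e' e := by
      by_cases h : w = (s i).root <;> by_cases h' : (s j).src f = (s j).root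
      · rw [h, h', compIn_root, compIn_root] at hw
        obtain ⟨e', h1⟩ := e'
        obtain rfl := he e' (Sum.inl_injective hw)
        have h2 := h1.symm.trans e.2
        cases h2
        exact ⟨rfl, HEq.rfl⟩
      · rw [h, compIn_root, compIn_ne _ _ _ _ h'] at hw
        cases hw
      · rw [h', compIn_root, compIn_ne _ _ _ _ h] at hw
        cases hw
      · rw [compIn_ne _ _ _ _ h, compIn_ne _ _ _ _ h'] at hw
        cases hw
        exact ⟨rfl, HEq.rfl⟩
    obtain ⟨rfl, h⟩ := key
    cases h
    exact ⟨f, compIn_injective _ _ _ _ hw, matches_of_eq rfl fun _ => rfl⟩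

end SyncTree

namespace SFST

variable {Sg : ℕ → Type u} {n p q : ℕ}

/-- The class of a finite tree. -/
def ofTree (t : {t : SyncTree Sg p // t.IsFinite}) : (SFST Sg).Hom 1 p :=
  Quotient.mk (FST.simEquiv Sg 1 p) fun _ => t

theorem exists_ofTree (x : (SFST Sg).Hom 1 p) : ∃ t, ofTree t = x := by
  obtain ⟨t, rfl⟩ := Quotient.exists_rep x
  refine ⟨t 0, congrArg (Quotient.mk _) (funext fun i => ?_)⟩
  rw [Subsingleton.elim i 0]

theorem ofTree_le_iff {t t' : {t : SyncTree Sg p // t.IsFinite}} :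
    (SFST Sg).le (ofTree t) (ofTree t') ↔ SyncTree.Sim t.1 t'.1 t.1.root t'.1.root :=
  le_mk.trans ⟨fun h => h 0, fun h _ => h⟩

/-- The evaluation of letters as their classes. -/
abbrev gen (Sg : ℕ → Type u) (k : ℕ) (σ : Sg k) : (SFST Sg).Hom 1 k := SFST.letter σ

/-- The tree of an edge with given label and subtrees at its targets. -/
theorem exists_edge_tree (hS : (SFST Sg).IsTheory) : ∀ (l : Label Sg p)
    (u : Fin l.arity → {t : SyncTree Sg p // t.IsFinite}),
    ∃ w : {t : SyncTree Sg p // t.IsFinite},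
      labelVal hS (gen Sg) l (fun i => ofTree (u i)) = ofTree w ∧
      (∃ e, w.1.src e = w.1.root) ∧
      ∀ e, w.1.src e = w.1.root → w.1.label e = l ∧
        ∀ (i : Fin l.arity) (i' : Fin (w.1.label e).arity), (i : ℕ) = i' →
          SyncTree.Sim (u i).1 w.1 (u i).1.root (w.1.tgt e i') ∧
          SyncTree.Sim w.1 (u i).1 (w.1.tgt e i') (u i).1.root
  | .exit i, u => ⟨⟨.exit Sg i, SyncTree.isFinite_exit i⟩, rfl, ⟨(), rfl⟩,
      fun _ _ => ⟨rfl, fun j => Fin.elim0 j⟩⟩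
  | .letter k σ, u => by
    let u' : Fin k → {t : SyncTree Sg p // t.IsFinite} := u
    refine ⟨⟨(SyncTree.letter σ).comp fun i => (u' i).1,
      (SyncTree.isFinite_letter σ).comp fun i => (u' i).2⟩, ?_, ⟨.inl ⟨none, trivial⟩, rfl⟩, ?_⟩
    · have h : tuple hS (n := k) (fun i => ofTree (u' i)) =
          Quotient.mk (FST.simEquiv Sg k p) u' :=
        hS.hom_ext fun i => (dist_comp_tuple _ _ _).trans (dist_comp_mk i u').symm
      exact congrArg ((SFST Sg).comp (SFST.letter σ)) h
    -- Only the edge labelled `σ` leaves the root; its `i`-th target is the root of the copy of `u'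
    -- i`. The remaining cases are contradictory.
    · rintro (⟨_ | j, he⟩ | ⟨i, ⟨_ | j, he⟩, f⟩) hs
      · refine ⟨rfl, fun i i' hi => ?_⟩
        obtain rfl : i = i' := Fin.ext hi
        refine ⟨?_, ?_⟩
        · have := SyncTree.sim_compIn (SyncTree.letter σ) (fun i => (u' i).1) i ⟨some i, rfl⟩
            (u' i).1.root
          rwa [SyncTree.compIn_root (SyncTree.letter σ) (fun i => (u' i).1) i ⟨some i, rfl⟩] at this
        · exact SyncTree.sim_inl_of_unique (t := SyncTree.letter σ) (fun i => (u' i).1)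
            (i := i) ⟨some i, rfl⟩ fun e' he' => he'
      · exact he.elim
      · cases he
      · cases he
        change SyncTree.compIn (SyncTree.letter σ) (fun i => (u' i).1) i ⟨some i, rfl⟩
          ((u' i).1.src f) = .inl none at hs
        by_cases hf : (u' i).1.src f = (u' i).1.root
        · rw [hf, SyncTree.compIn_root (SyncTree.letter σ) (fun i => (u' i).1)] at hs
          cases hs
        · rw [SyncTree.compIn_ne (SyncTree.letter σ) (fun i => (u' i).1) _ _ hf] at hs
          cases hs

/-- The representatives of `x` are simulated by the subtree of `t` at `v`. -/
def Below (x : (SFST Sg).Hom 1 p) (t : SyncTree Sg p) (v : t.V) : Prop :=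
  ∃ u, ofTree u = x ∧ SyncTree.Sim u.1 t u.1.root v

/-- Equal classes are simulation equivalent, so the choice of representative in `Below` does not
matter. -/
theorem below_ofTree {u : {t : SyncTree Sg p // t.IsFinite}} {t : SyncTree Sg p} {v : t.V} :
    Below (ofTree u) t v ↔ SyncTree.Sim u.1 t u.1.root v := by
  refine ⟨?_, fun h => ⟨u, rfl, h⟩⟩
  rintro ⟨u', h, h'⟩
  refine (ofTree_le_iff.1 ?_).trans h'
  rw [h]
  exact (isOrderedIdempotentGroveTheory Sg).le_refl _

/-- `Below` compares a class with an arbitrary vertex of `t`, so the order of `SFST` does not apply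
directly; a representative of the join is built summand by summand. -/
theorem below_join {t : SyncTree Sg p} {v : t.V} {ι : Type} [Finite ι]
    {f : ι → (SFST Sg).Hom 1 p} (h : ∀ i, Below (f i) t v) : Below (join f) t v := by
  have key : ∀ l : List ι, Below ((l.map f).foldr (SFST Sg).add ((SFST Sg).zero 1 p)) t v := by
    intro l
    induction l with
    | nil => exact ⟨⟨.zero Sg p, SyncTree.isFinite_zero⟩, rfl, SyncTree.sim_zero _ _⟩
    | cons a l ih =>
      obtain ⟨x, hx, hx'⟩ := h a
      obtain ⟨y, hy, hy'⟩ := ih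
      refine ⟨⟨x.1.add y.1, x.2.add y.2⟩, ?_, SyncTree.sim_add hx' hy'⟩
      rw [List.map_cons, List.foldr_cons, ← hx, ← hy]
      rfl
  exact key _

/-- The representative `u` plays the role of the subtree of `t` at `v`. By induction over vertices,
each edge `e` at `v` yields a tree `w` that is simulated by `t` at `v` and has a root edge matching
`e`. The value at `v` is the join of these trees: it lies below `v` because they all do, and it
simulates `v` because it lies above each of them. -/
theorem eval_gen (hS : (SFST Sg).IsTheory) (t : SyncTree Sg p) [Finite t.E] (v : t.V) :
    ∃ u : {t : SyncTree Sg p // t.IsFinite}, eval hS (gen Sg) t v = ofTree u ∧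
      SyncTree.Sim u.1 t u.1.root v ∧ SyncTree.Sim t u.1 v u.1.root := by
  have hI := isOrderedIdempotentGroveTheory Sg
  induction v using t.isChild_wellFounded.induction with
  | _ v ih =>
    have edge : ∀ e : {e : t.E // t.src e = v}, ∃ w : {t : SyncTree Sg p // t.IsFinite},
        labelVal hS (gen Sg) (t.label e.1) (fun i => eval hS (gen Sg) t (t.tgt e.1 i)) =
          ofTree w ∧ SyncTree.Sim w.1 t w.1.root v ∧
        ∃ e' : w.1.E, w.1.src e' = w.1.root ∧ SyncTree.Matches (SyncTree.Sim t w.1) e.1 e' := by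
      intro e
      choose u hu hu1 hu2 using fun i => ih (t.tgt e.1 i) ⟨e.1, i, e.2, rfl⟩
      -- The existence of a root edge `e'` supplies the match for `e`; the condition `H` on all root
      -- edges shows that `w` does nothing that `t` cannot do at `v`.
      obtain ⟨w, hw, ⟨e', he'⟩, H⟩ := exists_edge_tree hS (t.label e.1) u
      refine ⟨w, ?_, SyncTree.Sim.intro fun f hf => ?_, e', he', (H e' he').1, fun i i' hi => ?_⟩
      · rw [← hw]
        exact congrArg _ (funext hu)
      · refine ⟨e.1, e.2, (H f hf).1.symm, fun i i' hi => ?_⟩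
        exact (((H f hf).2 i' i hi.symm).2).trans (hu1 i')
      · exact (hu2 i).trans ((H e' he').2 i i' hi).1
    choose w hw hw1 hw2 using edge
    obtain ⟨u, hu⟩ := exists_ofTree (eval hS (gen Sg) t v)
    refine ⟨u, hu.symm, ?_, SyncTree.Sim.intro fun e he => ?_⟩
    · rw [← below_ofTree, hu, eval_eq]
      exact below_join fun e => ⟨w e, (hw e).symm, hw1 e⟩
    · obtain ⟨e', he', H⟩ := hw2 ⟨e, he⟩
      have hle : (SFST Sg).le (ofTree (w ⟨e, he⟩)) (ofTree u) := by
        rw [hu, ← hw, eval_eq]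
        exact le_join hI.toIsIdempotentGroveTheory
          (fun e : {e : t.E // t.src e = v} => labelVal hS (gen Sg) (t.label e.1)
            fun i => eval hS (gen Sg) t (t.tgt e.1 i)) ⟨e, he⟩
      have hsim := ofTree_le_iff.1 hle
      rw [← he'] at hsim
      obtain ⟨e'', he'', H'⟩ := hsim.exists_matches
      exact ⟨e'', he'', SyncTree.Matches.trans (R := SyncTree.Sim t (w ⟨e, he⟩).1)
        (S := SyncTree.Sim (w ⟨e, he⟩).1 u.1) (Q := SyncTree.Sim t u.1)
        (fun _ _ _ h h' => h.trans h') H H'⟩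

theorem eval_gen_root (hS : (SFST Sg).IsTheory) (t : {t : SyncTree Sg p // t.IsFinite}) :
    eval hS (gen Sg) t.1 t.1.root = ofTree t := by
  obtain ⟨u, hu, h, h'⟩ := eval_gen hS t.1 t.1.root
  rw [hu]
  exact (isOrderedIdempotentGroveTheory Sg).le_antisymm (ofTree_le_iff.2 h) (ofTree_le_iff.2 h')

/-! ### Uniqueness of the extension -/

/-- Values are built from letters by composition, tuples, distinguished morphisms and finite sums,
all of which `F` preserves. -/
theorem map_eval {S : GroveData.{w}} {T : GroveData.{w'}} (F : Morphism S T) (hS : S.IsTheory)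
    (hT : T.IsTheory) (ψ : (k : ℕ) → Sg k → S.Hom 1 k) (t : SyncTree Sg p) [Finite t.E] (v : t.V) :
    F.map (eval hS ψ t v) = eval hT (fun k σ => F.map (ψ k σ)) t v := by
  have hl : ∀ (l : Label Sg p) (x : Fin l.arity → S.Hom 1 p), F.map (labelVal hS ψ l x) =
      labelVal hT (fun k σ => F.map (ψ k σ)) l fun i => F.map (x i) := by
    rintro (⟨k, σ⟩ | i) x
    · exact (F.map_comp _ _).trans (congrArg _ (F.map_tuple hS hT _))
    · exact F.map_dist i
  induction v using t.isChild_wellFounded.induction with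
  | _ v ih =>
    rw [eval_eq, eval_eq, F.map_join]
    refine congrArg join (funext fun e => ?_)
    rw [hl]
    exact congrArg _ (funext fun i => ih _ ⟨e.1, i, e.2, rfl⟩)

theorem morphism_ext {T : GroveData.{w}} (hT : T.IsTheory) {F G : Morphism (SFST Sg) T}
    (h : ∀ (k : ℕ) (σ : Sg k), F.map (SFST.letter σ) = G.map (SFST.letter σ)) : F = G := by
  have hS := (isOrderedIdempotentGroveTheory Sg).toIsTheory
  refine Morphism.ext fun {n p} f => hT.hom_ext fun i => ?_
  -- The components of `F.map f` and `G.map f` are the images of the components of `f`, so it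
  -- suffices to compare `F` and `G` on classes of single trees.
  rw [← F.map_dist, ← F.map_comp, F.map_dist, ← G.map_dist, ← G.map_comp]
  obtain ⟨t, ht⟩ := exists_ofTree ((SFST Sg).comp ((SFST Sg).dist i) f)
  rw [← ht, ← eval_gen_root hS, map_eval F hS hT, map_eval G hS hT]
  simp only [gen, h]

end SFST

end GroveTheory

theorem mainTheorem10 (Sg : ℕ → Type u) :
    (GroveTheory.SFST Sg).IsOrderedIdempotentGroveTheory ∧
      ∀ (T : GroveTheory.GroveData.{w}), T.IsOrderedIdempotentGroveTheory →
        ∀ φ : (k : ℕ) → Sg k → T.Hom 1 k,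
          ∃! F : GroveTheory.GroveData.Morphism (GroveTheory.SFST Sg) T,
            ∀ (k : ℕ) (σ : Sg k), F.map (GroveTheory.SFST.letter σ) = φ k σ := by
  refine ⟨GroveTheory.SFST.isOrderedIdempotentGroveTheory Sg, fun T hT φ =>
    ⟨GroveTheory.SFST.lift hT φ, fun k σ => GroveTheory.SFST.lift_letter hT φ σ, fun F hF => ?_⟩⟩
  refine GroveTheory.SFST.morphism_ext hT.toIsTheory fun k σ => ?_
  rw [hF, GroveTheory.SFST.lift_letter]
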